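/- **Setting.** Let $\lambda,\lambda_e,\beta_e>0$, $\alpha\ge 2$ and $0<R_1\le R_2\le D$. Legitimate nodes and eavesdroppers are distributed over the disk $\mathcal B(o,D)\subset\mathbb R^2$ as independent homogeneous Poisson point processes $\Phi$ and $\Phi_E$ with intensities $\lambda$ and $\lambda_e$; the transmitter is at the origin $o$. Every node $x\in\Phi$ with $\|x\|\le R_1$ is a jammer; every node $x\in\Phi$ with $R_1<\|x\|\le R_2$ is, independently of everything else, selected as a jammer with probability $P(\|x\|)$, where, according to the policy $\Xi\in\{\mathrm E,\mathrm I,\mathrm D\}$, $$\mathrm E:\ P(r)=p\ \ (p\in[0,1]),\qquad \mathrm I:\ P(r)=\frac{r^\alpha-R_1^\alpha}{R_2^\alpha-R_1^\alpha},\qquad \mathrm D:\ P(r)=\frac{R_2^\alpha-r^\alpha}{R_2^\alpha-R_1^\alpha}.$$ Let $\Phi_J$ be the set of jammers. All fading coefficients $h_{x,y}$ (from sender $x$ to location $y$) are i.i.d. exponential with mean $1$, independent of $\Phi$, $\Phi_E$ and the selection. Put $I(y)=\sum_{x\in\Phi_J}h_{x,y}\|x-y\|^{-\alpha}$, $\mathcal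 L_{I(y)}(s)=\mathbb E[e^{-sI(y)}]$ for a deterministic location $y$ (it depends on $y$ only through $\|y\|$), $\mathrm{SIR}_z=h_{o,z}\|z\|^{-\alpha}/I(z)$ for $z\in\Phi_E$ ($=\infty$ if $I(z)=0$), and let $p_{so}=\mathbb P\big(\bigcup_{z\in\Phi_E}\{\mathrm{SIR}_z>\beta_e\}\big)$ be the secrecy outage probability. For $r>0$ let $z_r$ denote any location with $\|z_r\|=r$. **Theorem.** For each policy $\Xi\in\{\mathrm E,\mathrm I,\mathrm D\}$, $$\int_0^D 2\pi\lambda_e r\,e^{-\lambda_e\pi r^2}\,\mathcal L_{I(z_r)}(\beta_e r^\alpha)\,dr\ \le\ p_{so}\ \le\ 1-\exp\Big\{-2\pi\lambda_e\int_0^D\mathcal L_{I(z_r)}(\beta_e r^\alpha)\,r\,dr\Big\}.$$ Moreover, for $\alpha=2$ and $\alpha=4$ the Laplace transform is given, for $0<y\le D$ and $s=\beta_e y^\alpha$, as follows. (If $R_1=R_2$, the differences $\Psi_\alpha(R_2)-\Psi_\alpha(R_1)$ below are read as $0$.) * $\alpha=2$: with $A(r)=\operatorname{arcsinh}\frac{s+r^2-y^2}{2y\sqrt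 s}$ and $Q(r)=\sqrt{r^4+2(s-y^2)r^2+(s+y^2)^2}$, $$\mathcal L_{I(z_y)}(s)=\exp\Big\{-\lambda\pi s\Big[pA(R_2)+(1-p)A(R_1)-\ln\tfrac{\sqrt s}{y}\Big]\Big\}\quad\text{for }\Xi=\mathrm E,$$ $$\mathcal L_{I(z_y)}(s)=\exp\Big\{-\lambda\pi s\Big[\Psi_2^{\Xi}(R_2)-\Psi_2^{\Xi}(R_1)+A(R_1)-\ln\tfrac{\sqrt s}{y}\Big]\Big\}\quad\text{for }\Xi=\mathrm I,\mathrm D,$$ where $\Psi_2^{\mathrm I}(r)=\frac{Q(r)-(s+R_1^2-y^2)A(r)}{R_2^2-R_1^2}$ and $\Psi_2^{\mathrm D}(r)=\frac{(s+R_2^2-y^2)A(r)-Q(r)}{R_2^2-R_1^2}$. * $\alpha=4$: with $g(r)=(r^2-y^2)^2-s$, $\eta(r)=\frac{1}{\sqrt2}\sqrt{\sqrt{g(r)^2+4s(r^2+y^2)^2}+g(r)}$, $\psi(r)=\frac{\sqrt s(r^2+y^2)}{\eta(r)}$ and $T(r)=\arctan\frac{\sqrt s+\psi(r)}{\eta(r)+r^2-y^2}$,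 $$\mathcal L_{I(z_y)}(s)=\exp\Big\{-\lambda\pi\sqrt s\Big[\tfrac{\pi}{2}-(1-p)T(R_1)-pT(R_2)\Big]\Big\}\quad\text{for }\Xi=\mathrm E,$$ $$\mathcal L_{I(z_y)}(s)=\exp\Big\{-\lambda\pi\sqrt s\Big[\tfrac{\pi}{2}-T(R_1)+\Psi_4^{\Xi}(R_2)-\Psi_4^{\Xi}(R_1)\Big]\Big\}\quad\text{for }\Xi=\mathrm I,\mathrm D,$$ where, with $$V(r)=\frac{2\sqrt s\,y^2\ln\big[(\eta(r)+r^2-y^2)^2+(\sqrt s+\psi(r))^2\big]-\tfrac12\big[(r^2+3y^2)\psi(r)-3\sqrt s\,\eta(r)\big]}{R_2^4-R_1^4},$$ $\Psi_4^{\mathrm I}(r)=V(r)+\frac{s+R_1^4-y^4}{R_2^4-R_1^4}T(r)$ and $\Psi_4^{\mathrm D}(r)=-V(r)-\frac{s+R_2^4-y^4}{R_2^4-R_1^4}T(r)$. -/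

import Mathlib

open MeasureTheory ProbabilityTheory

/-- The Euclidean plane. -/
abbrev Plane : Type := EuclideanSpace ℝ (Fin 2)

/-- The number of points of the finite random configuration
`X 0, …, X (N - 1)` (counted with multiplicity) that lie in `B`. -/
noncomputable def pointCount {Ω : Type*} (N : Ω → ℕ) (X : ℕ → Ω → Plane) (B : Set Plane)
    (ω : Ω) : ℕ :=
  open Classical in ((Finset.range (N ω)).filter (fun i => X i ω ∈ B)).card

/-- The finite random configuration `X 0, …, X (N - 1)`, listed in any measurable way, is a
Poisson point process with (finite) intensity measure `Λ`: the number of points in a measurable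
set `B` is Poisson distributed with mean `Λ B`, and the numbers of points in finitely many
pairwise disjoint measurable sets are independent. -/
structure IsPoissonPointProcess {Ω : Type*} [MeasurableSpace Ω] (P : Measure Ω)
    (N : Ω → ℕ) (X : ℕ → Ω → Plane) (Λ : Measure Plane) : Prop where
  measurable_card : Measurable N
  measurable_point : ∀ i, Measurable (X i)
  law_count : ∀ B : Set Plane, MeasurableSet B →
    P.map (pointCount N X B) = poissonMeasure (Λ B).toNNReal
  indep_count : ∀ (n : ℕ) (B : Fin n → Set Plane), (∀ k, MeasurableSet (B k)) →
    (∀ k l, k ≠ l → Disjoint (B k) (B l)) →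
      iIndepFun (fun k => pointCount N X (B k)) P

/-- The three policies for selecting long-range jammers. Under policy `E` every legitimate node
of the annulus is selected with the same probability `p`. -/
inductive JammerPolicy : Type
  | E (p : Set.Icc (0 : ℝ) 1)
  | I
  | D

/-- The probability `P(r)` with which a legitimate node of the long-range friendship annulus
`R₁ < ‖x‖ ≤ R₂`, at distance `r` from the transmitter, is selected as a jammer. -/
noncomputable def JammerPolicy.prob (α R₁ R₂ : ℝ) (r : ℝ) : JammerPolicy → ℝ
  | .E p => (p : ℝ)
  | .I => (r ^ α - R₁ ^ α) / (R₂ ^ α - R₁ ^ α)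
  | .D => (R₂ ^ α - r ^ α) / (R₂ ^ α - R₁ ^ α)

/-- The random elements of the network. The transmitter sits at the origin.

In `fade a b`, the index `a` is the sender: `none` is the transmitter and `some i` is
the legitimate node `node i`. The index `b` is the place of reception: `some j` is the eavesdropper
`eve j`, and `none` is a deterministic location of the disk. -/
structure FriendshipNetwork (Ω : Type*) where
  /-- the number of legitimate nodes -/
  numNodes : Ω → ℕ
  /-- the locations of the legitimate nodes (those with index below `numNodes`) -/
  node : ℕ → Ω → Plane
  /-- the number of eavesdroppers -/
  numEves : Ω → ℕ
  /-- the locations of the eavesdroppers (those with index below `numEves`) -/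
  eve : ℕ → Ω → Plane
  /-- the random numbers that drive the selection of the long-range jammers -/
  sel : ℕ → Ω → ℝ
  /-- the (power) fading coefficients -/
  fade : Option ℕ → Option ℕ → Ω → ℝ

/-- The joint law of the network: the legitimate nodes and the eavesdroppers form homogeneous
Poisson point processes on the disk of radius `D`, of intensities `lam` and `lamE`; the selection
variables are i.i.d. uniform on `[0, 1]`; the fading coefficients are i.i.d. exponential with
mean `1` (Rayleigh fading); and these four families are mutually independent. -/
structure FriendshipNetwork.HasNetworkLaw {Ω : Type*} [MeasurableSpace Ω]
    (net : FriendshipNetwork Ω) (P : Measure Ω) (lam lamE D : ℝ) : Prop where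
  nodes_poisson : IsPoissonPointProcess P net.numNodes net.node
    (ENNReal.ofReal lam • (volume : Measure Plane).restrict (Metric.closedBall 0 D))
  eves_poisson : IsPoissonPointProcess P net.numEves net.eve
    (ENNReal.ofReal lamE • (volume : Measure Plane).restrict (Metric.closedBall 0 D))
  measurable_sel : ∀ i, Measurable (net.sel i)
  law_sel : ∀ i, P.map (net.sel i) = (volume : Measure ℝ).restrict (Set.Icc 0 1)
  indep_sel : iIndepFun net.sel P
  measurable_fade : ∀ a b, Measurable (net.fade a b)
  law_fade : ∀ a b, P.map (net.fade a b) = expMeasure 1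
  indep_fade : iIndepFun (fun c : Option ℕ × Option ℕ => net.fade c.1 c.2) P
  /-- mutual independence of nodes, eavesdroppers, selection variables and fading -/
  indep_blocks : iIndep
    ![MeasurableSpace.comap (fun ω => (net.numNodes ω, fun i => net.node i ω)) inferInstance,
      MeasurableSpace.comap (fun ω => (net.numEves ω, fun j => net.eve j ω)) inferInstance,
      MeasurableSpace.comap (fun ω i => net.sel i ω) inferInstance,
      MeasurableSpace.comap (fun ω a b => net.fade a b ω) inferInstance] P

namespace FriendshipNetwork

variable {Ω : Type*} (net : FriendshipNetwork Ω) (Ξ : JammerPolicy) (α R₁ R₂ : ℝ)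

/-- The (indices of the) jammers: all legitimate nodes in the local friendship circle of radius
`R₁`, and each legitimate node `x` of the annulus `R₁ < ‖x‖ ≤ R₂` with probability `P(‖x‖)`. -/
noncomputable def jammers (ω : Ω) : Finset ℕ :=
  open Classical in (Finset.range (net.numNodes ω)).filter (fun i =>
    ‖net.node i ω‖ ≤ R₁ ∨
      (R₁ < ‖net.node i ω‖ ∧ ‖net.node i ω‖ ≤ R₂ ∧
        net.sel i ω ≤ Ξ.prob α R₁ R₂ ‖net.node i ω‖))

/-- The sum interference caused by the jammers at the location `y`, received through the fading
channels with receiver index `b`. -/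
noncomputable def interference (b : Option ℕ) (y : Plane) (ω : Ω) : ℝ :=
  ∑ i ∈ net.jammers Ξ α R₁ R₂ ω, net.fade (some i) b ω * ‖net.node i ω - y‖ ^ (-α)

/-- The Laplace transform `s ↦ 𝔼 [exp (-s I(y))]` of the sum interference `I(y)` at the
deterministic location `y`. -/
noncomputable def laplaceInterference [MeasurableSpace Ω] (P : Measure Ω) (y : Plane)
    (s : ℝ) : ℝ :=
  ∫ ω, Real.exp (-s * net.interference Ξ α R₁ R₂ none y ω) ∂P

/-- The signal-to-interference ratio at the eavesdropper `eve j`. It is `∞` if there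
is a signal but no interference. -/
noncomputable def eveSIR (j : ℕ) (ω : Ω) : ENNReal :=
  ENNReal.ofReal (net.fade none (some j) ω * ‖net.eve j ω‖ ^ (-α)) /
    ENNReal.ofReal (net.interference Ξ α R₁ R₂ (some j) (net.eve j ω) ω)

/-- Secrecy outage: at least one eavesdropper has an SIR above the threshold `βe`. -/
def secrecyOutage (βe : ℝ) : Set Ω :=
  {ω | ∃ j < net.numEves ω, ENNReal.ofReal βe < net.eveSIR Ξ α R₁ R₂ j ω}

/-- The secrecy outage probability. -/
noncomputable def secrecyOutageProb [MeasurableSpace Ω] (P : Measure Ω) (βe : ℝ) : ℝ :=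
  P.real (net.secrecyOutage Ξ α R₁ R₂ βe)

end FriendshipNetwork

/-- The function `Ψ₂` for policies `I` and `D` (path loss exponent `2`), where `y` is the distance
to the transmitter; it is not used for policy `E`. -/
noncomputable def psiTwo (R₁ R₂ s y r : ℝ) : JammerPolicy → ℝ
  | .E _ => 0
  | .I => √(r ^ 4 + 2 * (s - y ^ 2) * r ^ 2 + (s + y ^ 2) ^ 2) / (R₂ ^ 2 - R₁ ^ 2)
      - (s + R₁ ^ 2 - y ^ 2) / (R₂ ^ 2 - R₁ ^ 2)
        * Real.arsinh ((s + r ^ 2 - y ^ 2) / (2 * y * √s))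
  | .D => (s + R₂ ^ 2 - y ^ 2) / (R₂ ^ 2 - R₁ ^ 2)
        * Real.arsinh ((s + r ^ 2 - y ^ 2) / (2 * y * √s))
      - √(r ^ 4 + 2 * (s - y ^ 2) * r ^ 2 + (s + y ^ 2) ^ 2) / (R₂ ^ 2 - R₁ ^ 2)

/-- The closed form of the Laplace transform at `s` of the interference at distance `y` from the
transmitter, for path loss exponent `2`. -/
noncomputable def laplaceTwo (lam R₁ R₂ s y : ℝ) : JammerPolicy → ℝ
  | .E p => Real.exp (-(lam * Real.pi * s *
      ((p : ℝ) * Real.arsinh ((s + R₂ ^ 2 - y ^ 2) / (2 * y * √s))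
        + (1 - (p : ℝ)) * Real.arsinh ((s + R₁ ^ 2 - y ^ 2) / (2 * y * √s))
        - Real.log (√s / y))))
  | Ξ => Real.exp (-(lam * Real.pi * s *
      (psiTwo R₁ R₂ s y R₂ Ξ - psiTwo R₁ R₂ s y R₁ Ξ
        + (Real.arsinh ((s + R₁ ^ 2 - y ^ 2) / (2 * y * √s)) - Real.log (√s / y)))))

/-- The function `g`. -/
noncomputable def gFour (r s y : ℝ) : ℝ := (r ^ 2 - y ^ 2) ^ 2 - s

/-- The function `η`. -/
noncomputable def etaFour (r s y : ℝ) : ℝ :=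
  √(√(gFour r s y ^ 2 + 4 * s * (r ^ 2 + y ^ 2) ^ 2) + gFour r s y) / √2

/-- The function `ψ`. -/
noncomputable def psiFour (r s y : ℝ) : ℝ := √s * (r ^ 2 + y ^ 2) / etaFour r s y

/-- The arctangent term of the closed forms for path loss exponent `4`. -/
noncomputable def arctanFour (r s y : ℝ) : ℝ :=
  Real.arctan ((√s + psiFour r s y) / (etaFour r s y + r ^ 2 - y ^ 2))

/-- The function `Ψ₄` for policies `I` and `D` (path loss exponent `4`); it is not used for
policy `E`. -/
noncomputable def bigPsiFour (R₁ R₂ s y r : ℝ) : JammerPolicy → ℝ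
  | .E _ => 0
  | .I => 2 * √s * y ^ 2 / (R₂ ^ 4 - R₁ ^ 4)
        * Real.log ((etaFour r s y + r ^ 2 - y ^ 2) ^ 2 + (√s + psiFour r s y) ^ 2)
      - 1 / (2 * (R₂ ^ 4 - R₁ ^ 4))
        * ((r ^ 2 + 3 * y ^ 2) * psiFour r s y - 3 * √s * etaFour r s y)
      + (s + R₁ ^ 4 - y ^ 4) / (R₂ ^ 4 - R₁ ^ 4) * arctanFour r s y
  | .D => -(2 * √s * y ^ 2 / (R₂ ^ 4 - R₁ ^ 4))
        * Real.log ((etaFour r s y + r ^ 2 - y ^ 2) ^ 2 + (√s + psiFour r s y) ^ 2)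
      + 1 / (2 * (R₂ ^ 4 - R₁ ^ 4))
        * ((r ^ 2 + 3 * y ^ 2) * psiFour r s y - 3 * √s * etaFour r s y)
      - (s + R₂ ^ 4 - y ^ 4) / (R₂ ^ 4 - R₁ ^ 4) * arctanFour r s y

/-- The closed form of the Laplace transform at `s` of the interference at distance `y` from the
transmitter, for path loss exponent `4`. -/
noncomputable def laplaceFour (lam R₁ R₂ s y : ℝ) : JammerPolicy → ℝ
  | .E p => Real.exp (-(lam * Real.pi * √s *
      (Real.pi / 2 - (1 - (p : ℝ)) * arctanFour R₁ s y - (p : ℝ) * arctanFour R₂ s y)))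
  | Ξ => Real.exp (-(lam * Real.pi * √s *
      (Real.pi / 2 - arctanFour R₁ s y
        + bigPsiFour R₁ R₂ s y R₂ Ξ - bigPsiFour R₁ R₂ s y R₁ Ξ)))

/-! Freeze the legitimate nodes and the selection variables. The fading is exponential, so an
eavesdropper at `z` has an SIR above `βe` with conditional probability `P(h > ∑ cᵢ hᵢ) = ∏ 1 / (1 +
cᵢ)`, where `cᵢ = βe ‖z‖^α ‖xᵢ - z‖^(-α)` and `i` runs over the jammers. The same product is the
conditional Laplace transform `condLaplace` of the interference at `z`, taken at `βe ‖z‖^α`.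
Distinct eavesdroppers use distinct fading variables, so given all locations these events are
independent (`integral_prod_ite_sum_lt`), and the generating functional of the eavesdropper process
yields `p_so = 1 - 𝔼 exp (-λₑ ∫ condLaplace)` (`secrecyOutageProb_eq`).

The upper bound is Jensen's inequality for `exp (-x)`. For the lower bound, keep only the
eavesdropper nearest to the origin: with the jammers fixed, this is the inequality
`integral_exp_neg_sq_le`, which is proved analytically. In both bounds Fubini and invariance under
isometries fixing the origin turn the mean of `condLaplace` into the Laplace transform of the
interference.

For the closed forms, integrating out the selection marks and applying the generating functional of
the nodes gives `exp (-λ ∫ jamProb · kernel)`. For `α = 2n` the kernel is rational in the squared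
distance. In polar coordinates the angular integral reduces to `∫ dθ / (c - b cos θ) = 2π / √(c² -
b²)`, with real `c` for `α = 2` and complex `c` for `α = 4`. All selection probabilities are affine
in `r^α`, so antiderivatives of the radial density and of `r^α` times it suffice; they come from an
arsinh for `α = 2` and from a complex logarithm for `α = 4`. -/

/-! ### Random sums and products; integration over independent elements. -/

theorem measurable_sum_range {α : Type*} [MeasurableSpace α] {n : α → ℕ} (hn : Measurable n)
    {g : ℕ → α → ℝ} (hg : ∀ i, Measurable (g i)) :
    Measurable fun a => ∑ i ∈ Finset.range (n a), g i a := by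
  have h : Measurable fun p : α × ℕ => ∑ i ∈ Finset.range p.2, g i p.1 :=
    measurable_from_prod_countable_left fun m =>
      Finset.measurable_fun_sum (Finset.range m) fun i _ => hg i
  exact h.comp (measurable_id.prodMk hn)

theorem measurable_prod_range {α : Type*} [MeasurableSpace α] {n : α → ℕ} (hn : Measurable n)
    {g : ℕ → α → ℝ} (hg : ∀ i, Measurable (g i)) :
    Measurable fun a => ∏ i ∈ Finset.range (n a), g i a := by
  have h : Measurable fun p : α × ℕ => ∏ i ∈ Finset.range p.2, g i p.1 :=
    measurable_from_prod_countable_left fun m =>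
      Finset.measurable_fun_prod (Finset.range m) fun i _ => hg i
  exact h.comp (measurable_id.prodMk hn)

/-- The integral of a bounded function of two independent random elements is an iterated
integral. -/
theorem IndepFun.integral_prodMk {Ω α β : Type*} [MeasurableSpace Ω] [MeasurableSpace α]
    [MeasurableSpace β] {P : Measure Ω} [IsProbabilityMeasure P] {X : Ω → α} {Y : Ω → β}
    (h : IndepFun X Y P) (hX : Measurable X) (hY : Measurable Y) {G : α × β → ℝ}
    (hG : Measurable G) {C : ℝ} (hC : ∀ p, ‖G p‖ ≤ C) :
    ∫ ω, G (X ω, Y ω) ∂P = ∫ ω, ∫ ω', G (X ω, Y ω') ∂P ∂P := by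
  have : IsProbabilityMeasure (P.map X) := Measure.isProbabilityMeasure_map hX.aemeasurable
  have : IsProbabilityMeasure (P.map Y) := Measure.isProbabilityMeasure_map hY.aemeasurable
  have e := (indepFun_iff_map_prod_eq_prod_map_map hX.aemeasurable hY.aemeasurable).1 h
  rw [← integral_map (φ := fun ω => (X ω, Y ω)) (hX.prodMk hY).aemeasurable
    hG.aestronglyMeasurable, e, integral_prod _
      (Integrable.of_bound hG.aestronglyMeasurable C (Filter.Eventually.of_forall hC)),
    integral_map hX.aemeasurable]
  · refine integral_congr_ae (Filter.Eventually.of_forall fun ω => ?_)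
    exact integral_map hY.aemeasurable (hG.comp measurable_prodMk_left).aestronglyMeasurable
  · exact (hG.stronglyMeasurable.integral_prod_right').aestronglyMeasurable

/-! ### Generating functional of a Poisson point process. -/

theorem integral_pow_poissonMeasure (r : NNReal) (c : ℝ) :
    ∫ n, c ^ n ∂(poissonMeasure r) = Real.exp (-(r * (1 - c))) := by
  rw [integral_poissonMeasure]
  have h : ∀ n : ℕ, (Real.exp (-(r : ℝ)) * (r : ℝ) ^ n / (n.factorial : ℝ)) • c ^ n =
      Real.exp (-(r : ℝ)) * ((r * c) ^ n / n.factorial) := fun n => by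
    rw [smul_eq_mul, mul_pow]; ring
  simp_rw [h]
  rw [tsum_mul_left, ← congrFun (NormedSpace.exp_eq_tsum_div (𝔸 := ℝ)) (r * c),
    ← Real.exp_eq_exp_ℝ, ← Real.exp_add]
  ring_nf

namespace IsPoissonPointProcess

theorem pointCount_eq_sum {Ω : Type*} {N : Ω → ℕ} {X : ℕ → Ω → Plane} (B : Set Plane) (ω : Ω) :
    (pointCount N X B ω : ℝ) =
      ∑ i ∈ Finset.range (N ω), B.indicator (fun _ => (1 : ℝ)) (X i ω) := by
  classical
  simp [pointCount, Set.indicator_apply]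

/-- Grouping the points by the value of `g` expresses the product through the counts in the level
sets of `g`, which are disjoint; the defining properties of the process apply to these. -/
theorem prod_simpleFunc_eq {Ω : Type*} {N : Ω → ℕ} {X : ℕ → Ω → Plane} (g : SimpleFunc Plane ℝ)
    (ω : Ω) :
    ∏ i ∈ Finset.range (N ω), g (X i ω) =
      ∏ c : g.range, (c : ℝ) ^ pointCount N X (g ⁻¹' {(c : ℝ)}) ω := by
  classical
  rw [← Finset.prod_fiberwise_of_maps_to (t := g.range) (g := fun i => g (X i ω))
    (fun i _ => SimpleFunc.mem_range_self g _),
    Finset.prod_coe_sort g.range (fun c => c ^ pointCount N X (g ⁻¹' {c}) ω)]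
  refine Finset.prod_congr rfl fun c _ => ?_
  rw [Finset.prod_congr rfl (g := fun _ => c) fun i hi => (Finset.mem_filter.1 hi).2,
    Finset.prod_const]
  congr 1

variable {Ω : Type*} [MeasurableSpace Ω] {P : Measure Ω}
  {N : Ω → ℕ} {X : ℕ → Ω → Plane} {Λ : Measure Plane}

theorem measurable_pointCount (h : IsPoissonPointProcess P N X Λ) {B : Set Plane}
    (hB : MeasurableSet B) : Measurable (pointCount N X B) := by
  have h1 : Measurable fun ω => (pointCount N X B ω : ℝ) := by
    simp_rw [pointCount_eq_sum]
    exact measurable_sum_range h.measurable_card fun i =>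
      (measurable_const.indicator hB).comp (h.measurable_point i)
  -- The natural-number count is recovered from its real version, a random sum of indicators, by
  -- taking the floor.
  have h2 : Measurable fun ω => ⌊(pointCount N X B ω : ℝ)⌋₊ := Nat.measurable_floor.comp h1
  simpa using h2

/-- Serves to exclude an eavesdropper exactly at the origin, where `‖z‖ ^ (-α)` takes a conventional
value. -/
theorem ae_forall_notMem (h : IsPoissonPointProcess P N X Λ) {B : Set Plane}
    (hB : MeasurableSet B) (h0 : Λ B = 0) : ∀ᵐ ω ∂P, ∀ i < N ω, X i ω ∉ B := by
  classical
  have h1 : ∀ᵐ n ∂(P.map (pointCount N X B)), n = 0 := by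
    rw [h.law_count B hB, h0, ae_iff]
    simpa [poissonMeasure] using fun i => (eq_or_ne i 0).symm.imp (fun hi => by simp [hi]) id
  filter_upwards [ae_of_ae_map (h.measurable_pointCount hB).aemeasurable h1] with ω hω i hi hx
  rw [pointCount, Finset.card_eq_zero] at hω
  exact Finset.notMem_empty i (hω ▸ Finset.mem_filter.2 ⟨Finset.mem_range.2 hi, hx⟩)

/-- The counts in the level sets are independent and Poisson, so each value `c` contributes the
factor `exp (-Λ(g = c) (1 - c))`; the exponents add up to the integral of `1 - g`. -/
theorem integral_prod_simpleFunc (h : IsPoissonPointProcess P N X Λ) [IsFiniteMeasure Λ]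
    (g : SimpleFunc Plane ℝ) :
    ∫ ω, ∏ i ∈ Finset.range (N ω), g (X i ω) ∂P = Real.exp (-∫ x, (1 - g x) ∂Λ) := by
  classical
  simp_rw [prod_simpleFunc_eq]
  let e := g.range.equivFin
  have hm : ∀ c : ℝ, MeasurableSet (g ⁻¹' {c}) := fun c => g.measurableSet_fiber c
  have hi : iIndepFun (fun c : g.range => pointCount N X (g ⁻¹' {(c : ℝ)})) P := by
    have := h.indep_count _ (fun k => g ⁻¹' {((e.symm k : g.range) : ℝ)}) (fun k => hm _)
      (fun k l hkl => (Set.disjoint_singleton.2 fun h' => hkl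
        (e.symm.injective (Subtype.ext h'))).preimage _)
    simpa using this.precomp e.injective
  rw [hi.integral_fun_prod_comp (f := fun (c : g.range) (n : ℕ) => (c : ℝ) ^ n)
    (fun c => (h.measurable_pointCount (hm c)).aemeasurable)
    (fun c => (measurable_from_nat).aestronglyMeasurable)]
  have h1 : ∀ c : g.range, ∫ ω, (c : ℝ) ^ pointCount N X (g ⁻¹' {(c : ℝ)}) ω ∂P =
      Real.exp (-(Λ.real (g ⁻¹' {(c : ℝ)}) * (1 - c))) := fun c => by
    rw [← integral_map (φ := pointCount N X (g ⁻¹' {(c : ℝ)})) (f := fun n => (c : ℝ) ^ n)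
      (h.measurable_pointCount (hm c)).aemeasurable measurable_from_nat.aestronglyMeasurable,
      h.law_count _ (hm c), integral_pow_poissonMeasure]
    rfl
  simp_rw [h1]
  rw [← Real.exp_sum, Finset.sum_neg_distrib,
    Finset.sum_coe_sort g.range (fun c => Λ.real (g ⁻¹' {c}) * (1 - c)),
    integral_sub (integrable_const _) g.integrable_of_isFiniteMeasure,
    SimpleFunc.integral_eq_sum g g.integrable_of_isFiniteMeasure,
    integral_const, ← Set.preimage_univ (f := g)]
  simp_rw [mul_sub, Finset.sum_sub_distrib, mul_one, smul_eq_mul, mul_one]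
  have h2 : ∑ c ∈ g.range, Λ.real (g ⁻¹' {c}) = Λ.real (g ⁻¹' Set.univ) := by
    rw [sum_measureReal_preimage_singleton _ fun c _ => hm c]
    congr 1
    ext x
    simp
  rw [h2]

variable [IsProbabilityMeasure P]

/-- The probability generating functional of a Poisson point process. -/
theorem integral_prod (h : IsPoissonPointProcess P N X Λ) [IsFiniteMeasure Λ]
    {f : Plane → ℝ} (hf : Measurable f) (h0 : ∀ x, 0 ≤ f x) (h1 : ∀ x, f x ≤ 1) :
    ∫ ω, ∏ i ∈ Finset.range (N ω), f (X i ω) ∂P = Real.exp (-∫ x, (1 - f x) ∂Λ) := by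
  have hz : (0 : ℝ) ∈ Set.Icc (0 : ℝ) 1 := by simp
  -- The approximations stay in `[0, 1]`, so the products and the functions `1 - g n` are bounded by
  -- `1` and dominated convergence applies on both sides.
  let g : ℕ → SimpleFunc Plane ℝ := fun n => SimpleFunc.approxOn f hf (Set.Icc 0 1) 0 hz n
  have hg : ∀ n x, g n x ∈ Set.Icc (0 : ℝ) 1 := fun n x => SimpleFunc.approxOn_mem hf hz n x
  have ht : ∀ x, Filter.Tendsto (fun n => g n x) Filter.atTop (nhds (f x)) := fun x =>
    SimpleFunc.tendsto_approxOn hf hz (subset_closure ⟨h0 x, h1 x⟩)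
  have l1 : Filter.Tendsto (fun n => ∫ ω, ∏ i ∈ Finset.range (N ω), g n (X i ω) ∂P) Filter.atTop
      (nhds (∫ ω, ∏ i ∈ Finset.range (N ω), f (X i ω) ∂P)) := by
    refine tendsto_integral_of_dominated_convergence (fun _ => 1) (fun n => ?_)
      (integrable_const _) (fun n => Filter.Eventually.of_forall fun ω => ?_)
      (Filter.Eventually.of_forall fun ω => tendsto_finsetProd _ fun i _ => ht _)
    · exact (measurable_prod_range h.measurable_card fun i =>
        (g n).measurable.comp (h.measurable_point i)).aestronglyMeasurable
    · rw [Real.norm_of_nonneg (Finset.prod_nonneg fun i _ => (hg n _).1)]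
      exact Finset.prod_le_one (fun i _ => (hg n _).1) fun i _ => (hg n _).2
  have l2 : Filter.Tendsto (fun n => ∫ x, (1 - g n x) ∂Λ) Filter.atTop
      (nhds (∫ x, (1 - f x) ∂Λ)) := by
    refine tendsto_integral_of_dominated_convergence (fun _ => 1) (fun n => ?_)
      (integrable_const _) (fun n => Filter.Eventually.of_forall fun x => ?_)
      (Filter.Eventually.of_forall fun x => (ht x).const_sub 1)
    · exact (measurable_const.sub (g n).measurable).aestronglyMeasurable
    · rw [Real.norm_of_nonneg (sub_nonneg.2 (hg n x).2)]
      linarith [(hg n x).1]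
  simp_rw [h.integral_prod_simpleFunc] at l1
  exact tendsto_nhds_unique l1 ((Real.continuous_exp.tendsto _).comp l2.neg)

end IsPoissonPointProcess

/-! ### Independent exponential variables (Rayleigh fading). -/

theorem iIndepFun.indepFun_of_measurable_iSup {Ω ι β γ : Type*} {mΩ : MeasurableSpace Ω}
    [MeasurableSpace β] [MeasurableSpace γ] {P : Measure Ω} {X : ι → Ω → ℝ} (h : iIndepFun X P)
    (hX : ∀ i, Measurable (X i)) {S T : Set ι} (hST : Disjoint S T) {f : Ω → β} {g : Ω → γ}
    (hf : Measurable[⨆ i ∈ S, MeasurableSpace.comap (X i) inferInstance] f)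
    (hg : Measurable[⨆ i ∈ T, MeasurableSpace.comap (X i) inferInstance] g) :
    IndepFun f g P := by
  have h1 := indep_iSup_of_disjoint (fun i => (hX i).comap_le) h.iIndep hST
  exact indep_of_indep_of_le_left (indep_of_indep_of_le_right h1 hg.comap_le) hf.comap_le

theorem measurable_iSup_comap {Ω ι : Type*} {X : ι → Ω → ℝ} {S : Set ι} {i : ι} (hi : i ∈ S) :
    Measurable[⨆ i ∈ S, MeasurableSpace.comap (X i) inferInstance] (X i) :=
  Measurable.of_comap_le (le_iSup₂_of_le i hi le_rfl)

/-- The two densities can differ only at `0`; the open half line is the domain of the improper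
integrals used below. -/
theorem expMeasure_one_eq : expMeasure 1 =
    (volume.restrict (Set.Ioi (0 : ℝ))).withDensity fun x => ENNReal.ofReal (Real.exp (-x)) := by
  rw [← withDensity_indicator measurableSet_Ioi]
  change volume.withDensity (exponentialPDF 1) = _
  refine withDensity_congr_ae ?_
  have : ∀ᵐ x : ℝ, x ≠ 0 := by simp [ae_iff]
  filter_upwards [this] with x hx
  rw [exponentialPDF_eq]
  rcases lt_or_gt_of_ne hx with h | h
  · simp [h.not_ge, h.le]
  · simp [h, h.le]

theorem integral_expMeasure_one (f : ℝ → ℝ) :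
    ∫ x, f x ∂(expMeasure 1) = ∫ x in Set.Ioi 0, Real.exp (-x) * f x := by
  rw [expMeasure_one_eq, integral_withDensity_eq_integral_toReal_smul (by fun_prop)
    (Filter.Eventually.of_forall fun x => ENNReal.ofReal_lt_top)]
  simp_rw [ENNReal.toReal_ofReal (Real.exp_pos _).le, smul_eq_mul]

theorem integral_exp_neg_mul_expMeasure {c : ℝ} (hc : 0 ≤ c) :
    ∫ x, Real.exp (-(x * c)) ∂(expMeasure 1) = 1 / (1 + c) := by
  rw [integral_expMeasure_one]
  have h : ∀ x : ℝ, Real.exp (-x) * Real.exp (-(x * c)) = Real.exp (-(1 + c) * x) := fun x => by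
    rw [← Real.exp_add]; ring_nf
  simp_rw [h]
  rw [integral_exp_mul_Ioi (by linarith), mul_zero, Real.exp_zero, neg_div_neg_eq]

theorem integral_ite_lt_expMeasure {c : ℝ} (hc : 0 ≤ c) :
    ∫ x, (if c < x then (1 : ℝ) else 0) ∂(expMeasure 1) = Real.exp (-c) := by
  rw [integral_expMeasure_one]
  have h : ∀ x : ℝ, Real.exp (-x) * (if c < x then (1 : ℝ) else 0) =
      (Set.Ioi c).indicator (fun x => Real.exp (-1 * x)) x := fun x => by
    simp [Set.indicator_apply]
  simp_rw [h]
  rw [setIntegral_indicator measurableSet_Ioi, Set.inter_eq_right.2 (Set.Ioi_subset_Ioi hc),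
    integral_exp_mul_Ioi (by norm_num)]
  simp

theorem ae_nonneg_expMeasure : ∀ᵐ x ∂(expMeasure 1), 0 ≤ x := by
  rw [expMeasure_one_eq]
  refine (withDensity_absolutelyContinuous _ _).ae_le ?_
  filter_upwards [ae_restrict_mem measurableSet_Ioi] with x hx using le_of_lt hx

theorem measurable_iSup_comap_sum {Ω ι : Type*} {X : ι → Ω → ℝ} (J : Finset ι) (c : ι → ℝ) {S : Set ι}
    (hS : ∀ i ∈ J, i ∈ S) :
    Measurable[⨆ i ∈ S, MeasurableSpace.comap (X i) inferInstance]
      fun ω => ∑ i ∈ J, X i ω * c i :=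
  @Finset.measurable_fun_sum ℝ ι Ω _ _ _ (⨆ i ∈ S, MeasurableSpace.comap (X i) inferInstance) _ J
    fun i hi => @Measurable.mul_const _ _ _ _ _ (_) _ (measurable_iSup_comap (hS i hi)) (c i)

section Rayleigh

variable {Ω ι : Type*} [MeasurableSpace Ω] {P : Measure Ω} {X : ι → Ω → ℝ}

theorem iIndepFun.integral_prod_finset (h : iIndepFun X P) (hX : ∀ i, Measurable (X i))
    (J : Finset ι) {f : ι → ℝ → ℝ} (hf : ∀ i, Measurable (f i)) :
    ∫ ω, ∏ i ∈ J, f i (X i ω) ∂P = ∏ i ∈ J, ∫ ω, f i (X i ω) ∂P := by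
  have h1 := (h.precomp (g := ((↑) : J → ι)) Subtype.val_injective).integral_fun_prod_comp
    (X := fun i : J => X i) (f := fun i : J => f i) (fun i => (hX i).aemeasurable) fun i => (hf i).aestronglyMeasurable
  rw [← Finset.prod_coe_sort, ← h1]
  exact integral_congr_ae (Filter.Eventually.of_forall fun ω =>
    (Finset.prod_coe_sort J fun i => f i (X i ω)).symm)

/-- The Laplace transform of a weighted sum of independent exponential random variables. -/
theorem integral_exp_neg_sum (h : iIndepFun X P) (hX : ∀ i, Measurable (X i))
    (hlaw : ∀ i, P.map (X i) = expMeasure 1) (J : Finset ι) {c : ι → ℝ} (hc : ∀ i, 0 ≤ c i) :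
    ∫ ω, Real.exp (-∑ i ∈ J, X i ω * c i) ∂P = ∏ i ∈ J, 1 / (1 + c i) := by
  simp_rw [← Finset.sum_neg_distrib, Real.exp_sum]
  rw [iIndepFun.integral_prod_finset h hX J (f := fun i x => Real.exp (-(x * c i)))
    fun i => by fun_prop]
  refine Finset.prod_congr rfl fun i _ => ?_
  rw [← integral_exp_neg_mul_expMeasure (hc i), ← hlaw i,
    integral_map (hX i).aemeasurable (by fun_prop)]

theorem measurable_ite_lt_one_zero {α : Type*} [MeasurableSpace α] {f g : α → ℝ}
    (hf : Measurable f) (hg : Measurable g) :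
    Measurable fun a => if f a < g a then (1 : ℝ) else 0 :=
  Measurable.ite (measurableSet_lt hf hg) measurable_const measurable_const

variable [IsProbabilityMeasure P]

/-- The probability that an exponential random variable exceeds an independent weighted sum of
independent exponential random variables. -/
theorem integral_ite_sum_lt (h : iIndepFun X P) (hX : ∀ i, Measurable (X i))
    (hlaw : ∀ i, P.map (X i) = expMeasure 1) (J : Finset ι) {c : ι → ℝ} (hc : ∀ i, 0 ≤ c i)
    {o : ι} (ho : o ∉ J) :
    ∫ ω, (if ∑ i ∈ J, X i ω * c i < X o ω then (1 : ℝ) else 0) ∂P = ∏ i ∈ J, 1 / (1 + c i) := by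
  have hind : IndepFun (fun ω => ∑ i ∈ J, X i ω * c i) (X o) P :=
    iIndepFun.indepFun_of_measurable_iSup h hX (S := (J : Set ι)) (T := {o}) (by simpa using ho)
      (measurable_iSup_comap_sum J c fun i hi => hi) (measurable_iSup_comap rfl)
  have hsum : Measurable fun ω => ∑ i ∈ J, X i ω * c i :=
    Finset.measurable_fun_sum J fun i _ => (hX i).mul_const _
  have h1 := IndepFun.integral_prodMk hind hsum (hX o)
    (G := fun p => if p.1 < p.2 then (1 : ℝ) else 0)
    (measurable_ite_lt_one_zero measurable_fst measurable_snd) (C := 1)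
    (fun p => by split_ifs <;> simp)
  rw [h1, ← integral_exp_neg_sum h hX hlaw J hc]
  -- The tail formula `exp (-c)` needs `0 ≤ c`, which the weighted sum satisfies only almost surely.
  have hnn : ∀ᵐ ω ∂P, ∀ i ∈ J, 0 ≤ X i ω := by
    rw [Filter.eventually_all_finset]
    intro i _
    exact ae_of_ae_map (hX i).aemeasurable (by rw [hlaw i]; exact ae_nonneg_expMeasure)
  refine integral_congr_ae ?_
  filter_upwards [hnn] with ω hω
  have h0 : 0 ≤ ∑ i ∈ J, X i ω * c i := Finset.sum_nonneg fun i hi => mul_nonneg (hω i hi) (hc i)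
  rw [← integral_ite_lt_expMeasure h0, ← hlaw o, integral_map (hX o).aemeasurable
    (measurable_ite_lt_one_zero measurable_const (g := fun x => x) measurable_id).aestronglyMeasurable]

end Rayleigh

/-- Independence of the columns of an array of independent exponential random variables: the
probability that in none of the first `m` columns the distinguished entry exceeds the weighted sum
of the entries in the rows `J`. -/
theorem integral_prod_ite_sum_lt {Ω : Type*} [MeasurableSpace Ω] {P : Measure Ω}
    [IsProbabilityMeasure P] {h : Option ℕ → Option ℕ → Ω → ℝ}
    (hi : iIndepFun (fun c : Option ℕ × Option ℕ => h c.1 c.2) P)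
    (hm : ∀ a b, Measurable (h a b)) (hlaw : ∀ a b, P.map (h a b) = expMeasure 1)
    (J : Finset ℕ) {c : ℕ → ℕ → ℝ} (hc : ∀ i j, 0 ≤ c i j) (m : ℕ) :
    ∫ ω, ∏ j ∈ Finset.range m, (1 - if ∑ i ∈ J, h (some i) (some j) ω * c i j <
        h none (some j) ω then (1 : ℝ) else 0) ∂P =
      ∏ j ∈ Finset.range m, (1 - ∏ i ∈ J, 1 / (1 + c i j)) := by
  induction m with
  | zero => simp
  | succ m ih =>
    simp_rw [Finset.prod_range_succ]
    let X : Option ℕ × Option ℕ → Ω → ℝ := fun c => h c.1 c.2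
    -- The first `m` columns and column `m` involve disjoint sets of entries, hence are independent.
    let S : Set (Option ℕ × Option ℕ) := {p | ∃ j < m, p.2 = some j}
    let T : Set (Option ℕ × Option ℕ) := {p | p.2 = some m}
    have hcol : ∀ (U : Set (Option ℕ × Option ℕ)) (j : ℕ), (∀ p, p.2 = some j → p ∈ U) →
        Measurable[⨆ i ∈ U, MeasurableSpace.comap (X i) inferInstance]
          fun ω => 1 - if ∑ i ∈ J, h (some i) (some j) ω * c i j <
            h none (some j) ω then (1 : ℝ) else 0 := by
      intro U j hU
      refine @Measurable.const_sub _ _ _ _ _ (_) _ (@measurable_ite_lt_one_zero _ (_) _ _ ?_ ?_) 1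
      · exact @Finset.measurable_fun_sum ℝ _ Ω _ _ _ (_) _ J fun i _ =>
          @Measurable.mul_const _ _ _ _ _ (_) _
            (measurable_iSup_comap (X := X) (i := (some i, some j)) (hU _ rfl)) (c i j)
      · exact measurable_iSup_comap (X := X) (i := (none, some j)) (hU _ rfl)
    have hind := iIndepFun.indepFun_of_measurable_iSup (X := X) hi (fun p => hm p.1 p.2)
      (S := S) (T := T)
      (Set.disjoint_left.2 fun p ⟨j, hj, hp⟩ (hp' : p.2 = some m) => by
        rw [hp] at hp'; exact hj.ne (Option.some.inj hp'))
      (@Finset.measurable_fun_prod ℝ _ Ω _ _ _ (_) _ (Finset.range m) fun j hj =>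
        hcol S j fun p hp => ⟨j, Finset.mem_range.1 hj, hp⟩)
      (hcol T m fun p hp => hp)
    have hmeas : ∀ j, Measurable fun ω => 1 - if ∑ i ∈ J, h (some i) (some j) ω * c i j <
            h none (some j) ω then (1 : ℝ) else 0 := fun j =>
      (measurable_ite_lt_one_zero (Finset.measurable_fun_sum J fun i _ => (hm _ _).mul_const _)
        (hm _ _)).const_sub 1
    rw [hind.integral_fun_mul_eq_mul_integral
      (Finset.measurable_fun_prod _ fun j _ => hmeas j).aestronglyMeasurable
      (hmeas m).aestronglyMeasurable, ih]
    congr 1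
    have hint : Integrable (fun ω => if ∑ i ∈ J, h (some i) (some m) ω * c i m <
            h none (some m) ω then (1 : ℝ) else 0) P :=
      Integrable.of_bound (measurable_ite_lt_one_zero
        (Finset.measurable_fun_sum J fun i _ => (hm _ _).mul_const _)
        (hm _ _)).aestronglyMeasurable 1
        (Filter.Eventually.of_forall fun ω => by split_ifs <;> simp)
    rw [integral_sub (integrable_const _) hint, integral_const, probReal_univ, one_smul]
    congr 1
    -- A single column: the distinguished entry has index `none`, the others are the `some i`. The
    -- weight `0` at `none` is a dummy, because `none` is not in the image of `J`.
    have := integral_ite_sum_lt (X := fun a => h a (some m)) (P := P)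
      (hi.precomp (g := fun a => (a, some m)) fun a b hab => congrArg Prod.fst hab)
      (fun a => hm a _) (fun a => hlaw a _) (J.map ⟨some, Option.some_injective ℕ⟩)
      (c := fun a => a.elim 0 fun i => c i m)
      (fun a => by cases a <;> simp [hc]) (o := none) (by simp)
    simpa using this

/-! ### Jammer selection and the conditional Laplace transform. -/

namespace JammerPolicy

variable (Ξ : JammerPolicy) (α R₁ R₂ : ℝ)

theorem measurable_prob : Measurable fun r => Ξ.prob α R₁ R₂ r := by
  cases Ξ <;> simp only [prob] <;> fun_prop

theorem prob_mem_Icc {α R₁ R₂ : ℝ} (hα : 0 ≤ α) (hR₁ : 0 < R₁) {r : ℝ} (h₁ : R₁ < r)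
    (h₂ : r ≤ R₂) : Ξ.prob α R₁ R₂ r ∈ Set.Icc (0 : ℝ) 1 := by
  have e1 : R₁ ^ α ≤ r ^ α := Real.rpow_le_rpow hR₁.le h₁.le hα
  have e2 : r ^ α ≤ R₂ ^ α := Real.rpow_le_rpow (hR₁.trans h₁).le h₂ hα
  cases Ξ with
  | E p => exact p.2
  | I =>
    exact ⟨div_nonneg (by linarith) (by linarith),
      div_le_one_of_le₀ (by linarith) (by linarith)⟩
  | D =>
    exact ⟨div_nonneg (by linarith) (by linarith),
      div_le_one_of_le₀ (by linarith) (by linarith)⟩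

/-- The event that a legitimate node at `x` with selection variable `v` is a jammer. -/
def IsJammer (x : Plane) (v : ℝ) : Prop :=
  ‖x‖ ≤ R₁ ∨ (R₁ < ‖x‖ ∧ ‖x‖ ≤ R₂ ∧ v ≤ Ξ.prob α R₁ R₂ ‖x‖)

theorem measurableSet_isJammer :
    MeasurableSet {p : Plane × ℝ | Ξ.IsJammer α R₁ R₂ p.1 p.2} := by
  have hn : Measurable fun p : Plane × ℝ => ‖p.1‖ := measurable_fst.norm
  exact (measurableSet_le hn measurable_const).union
    ((measurableSet_lt measurable_const hn).inter ((measurableSet_le hn measurable_const).inter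
      (measurableSet_le measurable_snd ((Ξ.measurable_prob α R₁ R₂).comp hn))))

open Classical in
/-- `w x` if a legitimate node at `x` with selection variable `v` is a jammer, and `d`
otherwise. -/
noncomputable def jamIte (d w : ℝ) (x : Plane) (v : ℝ) : ℝ :=
  if Ξ.IsJammer α R₁ R₂ x v then w else d

theorem measurable_jamIte (d : ℝ) {β : Type*} [MeasurableSpace β] {w : β → ℝ} {x : β → Plane}
    {v : β → ℝ} (hw : Measurable w) (hx : Measurable x) (hv : Measurable v) :
    Measurable fun b => Ξ.jamIte α R₁ R₂ d (w b) (x b) (v b) :=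
  Measurable.ite ((hx.prodMk hv) (Ξ.measurableSet_isJammer α R₁ R₂)) hw measurable_const

/-- The conditional Laplace transform of the interference at `z` caused by the legitimate node at
`x` with selection variable `v`. -/
noncomputable def jamFactor (t : ℝ) (z x : Plane) (v : ℝ) : ℝ :=
  Ξ.jamIte α R₁ R₂ 1 (1 / (1 + t * ‖x - z‖ ^ (-α))) x v

theorem measurable_jamFactor {β : Type*} [MeasurableSpace β] {t : β → ℝ} {z x : β → Plane}
    {v : β → ℝ} (ht : Measurable t) (hz : Measurable z) (hx : Measurable x) (hv : Measurable v) :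
    Measurable fun b => Ξ.jamFactor α R₁ R₂ (t b) (z b) (x b) (v b) :=
  Ξ.measurable_jamIte α R₁ R₂ 1 (by fun_prop) hx hv

theorem jamFactor_mem_Icc {t : ℝ} (ht : 0 ≤ t) (z x : Plane) (v : ℝ) :
    Ξ.jamFactor α R₁ R₂ t z x v ∈ Set.Icc (0 : ℝ) 1 := by
  have h : 0 ≤ t * ‖x - z‖ ^ (-α) := by positivity
  unfold jamFactor jamIte
  split_ifs
  · exact ⟨by positivity, div_le_one_of_le₀ (by linarith) (by linarith)⟩
  · simp

end JammerPolicy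

namespace FriendshipNetwork

variable {Ω : Type*} (net : FriendshipNetwork Ω) (Ξ : JammerPolicy) (α R₁ R₂ : ℝ)

/-- The conditional Laplace transform at `t` of the interference at `z`, given the legitimate
nodes and their selection variables. -/
noncomputable def condLaplace (t : ℝ) (z : Plane) (ω : Ω) : ℝ :=
  ∏ i ∈ Finset.range (net.numNodes ω), Ξ.jamFactor α R₁ R₂ t z (net.node i ω) (net.sel i ω)

theorem condLaplace_mem_Icc {t : ℝ} (ht : 0 ≤ t) (z : Plane) (ω : Ω) :
    net.condLaplace Ξ α R₁ R₂ t z ω ∈ Set.Icc (0 : ℝ) 1 :=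
  ⟨Finset.prod_nonneg fun _ _ => (Ξ.jamFactor_mem_Icc α R₁ R₂ ht _ _ _).1,
    Finset.prod_le_one (fun _ _ => (Ξ.jamFactor_mem_Icc α R₁ R₂ ht _ _ _).1)
      fun _ _ => (Ξ.jamFactor_mem_Icc α R₁ R₂ ht _ _ _).2⟩

/-- Replaces the random index set by a range with a neutral default value, the form in which
`measurable_sum_range` applies and in which the dependence on the independent blocks is explicit. -/
theorem sum_jammers (f : ℕ → ℝ) (ω : Ω) : ∑ i ∈ net.jammers Ξ α R₁ R₂ ω, f i =
    ∑ i ∈ Finset.range (net.numNodes ω),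
      Ξ.jamIte α R₁ R₂ 0 (f i) (net.node i ω) (net.sel i ω) := by
  rw [jammers, Finset.sum_filter]
  refine Finset.sum_congr rfl fun i _ => ?_
  simp only [JammerPolicy.jamIte, JammerPolicy.IsJammer]
  congr

theorem prod_jammers (f : ℕ → ℝ) (ω : Ω) : ∏ i ∈ net.jammers Ξ α R₁ R₂ ω, f i =
    ∏ i ∈ Finset.range (net.numNodes ω),
      Ξ.jamIte α R₁ R₂ 1 (f i) (net.node i ω) (net.sel i ω) := by
  rw [jammers, Finset.prod_filter]
  refine Finset.prod_congr rfl fun i _ => ?_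
  simp only [JammerPolicy.jamIte, JammerPolicy.IsJammer]
  congr

theorem condLaplace_eq_prod_jammers (t : ℝ) (z : Plane) (ω : Ω) :
    net.condLaplace Ξ α R₁ R₂ t z ω =
      ∏ i ∈ net.jammers Ξ α R₁ R₂ ω, 1 / (1 + t * ‖net.node i ω - z‖ ^ (-α)) := by
  rw [prod_jammers]
  rfl

theorem mul_interference_eq (b : Option ℕ) (s : ℝ) (y : Plane) (ω : Ω) :
    s * net.interference Ξ α R₁ R₂ b y ω = ∑ i ∈ net.jammers Ξ α R₁ R₂ ω,
      net.fade (some i) b ω * (s * ‖net.node i ω - y‖ ^ (-α)) := by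
  rw [interference, Finset.mul_sum]
  exact Finset.sum_congr rfl fun i _ => by ring

/-- The legitimate nodes. -/
def nodeBlock (ω : Ω) : ℕ × (ℕ → Plane) := (net.numNodes ω, fun i => net.node i ω)

/-- The eavesdroppers. -/
def eveBlock (ω : Ω) : ℕ × (ℕ → Plane) := (net.numEves ω, fun j => net.eve j ω)

/-- The selection variables. -/
def selBlock (ω : Ω) : ℕ → ℝ := fun i => net.sel i ω

/-- The fading coefficients. -/
def fadeBlock (ω : Ω) : Option ℕ → Option ℕ → ℝ := fun a b => net.fade a b ω

namespace HasNetworkLaw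

variable {net Ξ α R₁ R₂} [MeasurableSpace Ω] {P : Measure Ω} {lam lamE D : ℝ}

theorem measurable_nodeBlock (h : net.HasNetworkLaw P lam lamE D) : Measurable net.nodeBlock :=
  h.nodes_poisson.measurable_card.prodMk (measurable_pi_lambda _ h.nodes_poisson.measurable_point)

theorem measurable_eveBlock (h : net.HasNetworkLaw P lam lamE D) : Measurable net.eveBlock :=
  h.eves_poisson.measurable_card.prodMk (measurable_pi_lambda _ h.eves_poisson.measurable_point)

theorem measurable_selBlock (h : net.HasNetworkLaw P lam lamE D) : Measurable net.selBlock :=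
  measurable_pi_lambda _ h.measurable_sel

theorem measurable_fadeBlock (h : net.HasNetworkLaw P lam lamE D) : Measurable net.fadeBlock :=
  measurable_pi_lambda _ fun a => measurable_pi_lambda _ fun b => h.measurable_fade a b

/-- The first pair determines the jammers. Its independence from the rest is what permits
integrating over eavesdroppers and fading with the jammers frozen. -/
theorem indepFun_blocks (h : net.HasNetworkLaw P lam lamE D) :
    IndepFun (fun ω => (net.nodeBlock ω, net.selBlock ω))
      (fun ω => (net.eveBlock ω, net.fadeBlock ω)) P := by
  have h1 := indep_iSup_of_disjoint (S := {0, 2}) (T := {1, 3}) (fun i => by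
    fin_cases i
    · exact h.measurable_nodeBlock.comap_le
    · exact h.measurable_eveBlock.comap_le
    · exact h.measurable_selBlock.comap_le
    · exact h.measurable_fadeBlock.comap_le) h.indep_blocks (by simp)
  refine indep_of_indep_of_le_left (indep_of_indep_of_le_right h1 ?_) ?_
  · refine Measurable.comap_le ?_
    exact @Measurable.prodMk _ _ _ _ _ (_) _ _
      (Measurable.of_comap_le (le_iSup₂_of_le 1 (by simp) le_rfl))
      (Measurable.of_comap_le (le_iSup₂_of_le 3 (by simp) le_rfl))
  · refine Measurable.comap_le ?_
    exact @Measurable.prodMk _ _ _ _ _ (_) _ _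
      (Measurable.of_comap_le (le_iSup₂_of_le 0 (by simp) le_rfl))
      (Measurable.of_comap_le (le_iSup₂_of_le 2 (by simp) le_rfl))

theorem indepFun_nodeBlock_selBlock (h : net.HasNetworkLaw P lam lamE D) :
    IndepFun net.nodeBlock net.selBlock P := by
  have h1 := indep_iSup_of_disjoint (S := {0}) (T := {2}) (fun i => by
    fin_cases i
    · exact h.measurable_nodeBlock.comap_le
    · exact h.measurable_eveBlock.comap_le
    · exact h.measurable_selBlock.comap_le
    · exact h.measurable_fadeBlock.comap_le) h.indep_blocks (by simp)
  exact indep_of_indep_of_le_left (indep_of_indep_of_le_right h1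
    (le_iSup₂_of_le 2 (by simp) le_rfl)) (le_iSup₂_of_le 0 (by simp) le_rfl)

theorem indepFun_eveBlock_fadeBlock (h : net.HasNetworkLaw P lam lamE D) :
    IndepFun net.eveBlock net.fadeBlock P := by
  have h1 := indep_iSup_of_disjoint (S := {1}) (T := {3}) (fun i => by
    fin_cases i
    · exact h.measurable_nodeBlock.comap_le
    · exact h.measurable_eveBlock.comap_le
    · exact h.measurable_selBlock.comap_le
    · exact h.measurable_fadeBlock.comap_le) h.indep_blocks (by simp)
  exact indep_of_indep_of_le_left (indep_of_indep_of_le_right h1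
    (le_iSup₂_of_le 3 (by simp) le_rfl)) (le_iSup₂_of_le 1 (by simp) le_rfl)

theorem measurable_condLaplace (h : net.HasNetworkLaw P lam lamE D) {t : Plane → ℝ}
    (ht : Measurable t) :
    Measurable fun p : Ω × Plane => net.condLaplace Ξ α R₁ R₂ (t p.2) p.2 p.1 :=
  measurable_prod_range (h.nodes_poisson.measurable_card.comp measurable_fst) fun i =>
    Ξ.measurable_jamFactor α R₁ R₂ (ht.comp measurable_snd) measurable_snd
      ((h.nodes_poisson.measurable_point i).comp measurable_fst)
      ((h.measurable_sel i).comp measurable_fst)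

theorem ae_fade_nonneg (h : net.HasNetworkLaw P lam lamE D) :
    ∀ᵐ ω ∂P, ∀ a b, 0 ≤ net.fade a b ω := by
  rw [ae_all_iff]
  intro a
  rw [ae_all_iff]
  intro b
  exact ae_of_ae_map (h.measurable_fade a b).aemeasurable
    (by rw [h.law_fade a b]; exact ae_nonneg_expMeasure)

variable [IsProbabilityMeasure P]

/-- With nodes and selection frozen, the fading average of `exp (-s I)` is a product of Laplace
transforms of exponential variables. -/
theorem laplaceInterference_eq (h : net.HasNetworkLaw P lam lamE D) (y : Plane) {s : ℝ}
    (hs : 0 ≤ s) :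
    net.laplaceInterference Ξ α R₁ R₂ P y s = ∫ ω, net.condLaplace Ξ α R₁ R₂ s y ω ∂P := by
  -- The truncation at `1` supplies the bound required for iterated integration. It is almost surely
  -- inactive, since the fading is almost surely nonnegative.
  let G : (((ℕ × (ℕ → Plane)) × (ℕ → ℝ)) × (Option ℕ → Option ℕ → ℝ)) → ℝ := fun p =>
    min (Real.exp (-∑ i ∈ Finset.range p.1.1.1, Ξ.jamIte α R₁ R₂ 0
      (p.2 (some i) none * (s * ‖p.1.1.2 i - y‖ ^ (-α))) (p.1.1.2 i) (p.1.2 i))) 1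
  have hG : Measurable G := by
    refine ((measurable_sum_range (by fun_prop) fun i => ?_).neg.exp).min measurable_const
    exact Ξ.measurable_jamIte α R₁ R₂ 0 (by fun_prop) (by fun_prop) (by fun_prop)
  have hGb : ∀ p, ‖G p‖ ≤ 1 := fun p => by
    rw [Real.norm_of_nonneg (le_min (Real.exp_pos _).le zero_le_one)]
    exact min_le_right _ _
  have hGe : ∀ ω ω', G ((net.nodeBlock ω, net.selBlock ω), net.fadeBlock ω') =
      min (Real.exp (-∑ i ∈ net.jammers Ξ α R₁ R₂ ω,
        net.fade (some i) none ω' * (s * ‖net.node i ω - y‖ ^ (-α)))) 1 := fun ω ω' => by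
    rw [sum_jammers]
    rfl
  have hGn : ∀ ω, ∀ᵐ ω' ∂P, G ((net.nodeBlock ω, net.selBlock ω), net.fadeBlock ω') =
      Real.exp (-∑ i ∈ net.jammers Ξ α R₁ R₂ ω,
        net.fade (some i) none ω' * (s * ‖net.node i ω - y‖ ^ (-α))) := fun ω => by
    filter_upwards [h.ae_fade_nonneg] with ω' hω'
    rw [hGe, min_eq_left]
    rw [Real.exp_le_one_iff, neg_nonpos]
    exact Finset.sum_nonneg fun i _ => mul_nonneg (hω' _ _) (by positivity)
  have h1 : net.laplaceInterference Ξ α R₁ R₂ P y s =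
      ∫ ω, G ((net.nodeBlock ω, net.selBlock ω), net.fadeBlock ω) ∂P := by
    refine integral_congr_ae ?_
    filter_upwards [h.ae_fade_nonneg] with ω hω
    rw [hGe, min_eq_left, neg_mul, mul_interference_eq]
    rw [Real.exp_le_one_iff, neg_nonpos]
    exact Finset.sum_nonneg fun i _ => mul_nonneg (hω _ _) (by positivity)
  rw [h1, IndepFun.integral_prodMk
    (X := fun ω => (net.nodeBlock ω, net.selBlock ω)) (Y := net.fadeBlock)
    (h.indepFun_blocks.comp measurable_id measurable_snd)
    (h.measurable_nodeBlock.prodMk h.measurable_selBlock) h.measurable_fadeBlock hG hGb]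
  refine integral_congr_ae (Filter.Eventually.of_forall fun ω => ?_)
  refine (integral_congr_ae (hGn ω)).trans ?_
  rw [condLaplace_eq_prod_jammers]
  exact integral_exp_neg_sum (X := fun i => net.fade (some i) none)
    (h.indep_fade.precomp (g := fun i : ℕ => (some i, none)) fun i j hij => by simpa using hij)
    (fun i => h.measurable_fade _ _) (fun i => h.law_fade _ _) _ fun i => by positivity

end HasNetworkLaw

end FriendshipNetwork

/-! ### Outage probability after averaging over fading and eavesdroppers. -/

namespace FriendshipNetwork

namespace HasNetworkLaw

variable {Ω : Type*} {net : FriendshipNetwork Ω} {Ξ : JammerPolicy} {α R₁ R₂ : ℝ}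
  [MeasurableSpace Ω] {P : Measure Ω} {lam lamE D : ℝ}

theorem measurableSet_secrecyOutage (h : net.HasNetworkLaw P lam lamE D) (βe : ℝ) :
    MeasurableSet (net.secrecyOutage Ξ α R₁ R₂ βe) := by
  have hI : ∀ j, Measurable fun ω =>
      net.interference Ξ α R₁ R₂ (some j) (net.eve j ω) ω := fun j => by
    simp only [interference, sum_jammers]
    refine measurable_sum_range h.nodes_poisson.measurable_card fun i => ?_
    have h1 := h.nodes_poisson.measurable_point i
    have h2 := h.eves_poisson.measurable_point j
    have h3 := h.measurable_fade (some i) (some j)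
    exact Ξ.measurable_jamIte α R₁ R₂ 0 (by fun_prop) h1 (h.measurable_sel i)
  have hS : ∀ j, Measurable fun ω => net.eveSIR Ξ α R₁ R₂ j ω := fun j => by
    have h2 := h.eves_poisson.measurable_point j
    have h3 := h.measurable_fade none (some j)
    have h4 := hI j
    unfold eveSIR
    fun_prop
  have : net.secrecyOutage Ξ α R₁ R₂ βe = ⋃ j, ({ω | j < net.numEves ω} ∩
      {ω | ENNReal.ofReal βe < net.eveSIR Ξ α R₁ R₂ j ω}) := by
    ext ω
    simp [secrecyOutage]
  rw [this]
  exact MeasurableSet.iUnion fun j =>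
    (measurableSet_lt measurable_const h.eves_poisson.measurable_card).inter
      (measurableSet_lt measurable_const (hS j))

omit [MeasurableSpace Ω] in
-- Clearing denominators compares one fading variable with a weighted sum of others. Division in
-- `ENNReal` also covers zero interference, where both sides say that the signal is positive.
theorem lt_eveSIR_iff {βe : ℝ} (hβe : 0 < βe) {j : ℕ} {ω : Ω} (hf : ∀ a b, 0 ≤ net.fade a b ω)
    (hz : net.eve j ω ≠ 0) :
    ENNReal.ofReal βe < net.eveSIR Ξ α R₁ R₂ j ω ↔
      ∑ i ∈ net.jammers Ξ α R₁ R₂ ω, net.fade (some i) (some j) ω *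
        (βe * ‖net.eve j ω‖ ^ α * ‖net.node i ω - net.eve j ω‖ ^ (-α)) <
          net.fade none (some j) ω := by
  have hz' : 0 < ‖net.eve j ω‖ := norm_pos_iff.2 hz
  have hI : 0 ≤ net.interference Ξ α R₁ R₂ (some j) (net.eve j ω) ω :=
    Finset.sum_nonneg fun i _ => mul_nonneg (hf _ _) (by positivity)
  rw [← mul_interference_eq, eveSIR, ENNReal.lt_div_iff_mul_lt (Or.inr ENNReal.ofReal_ne_top)
    (Or.inl ENNReal.ofReal_ne_top), ← ENNReal.ofReal_mul hβe.le,
    ENNReal.ofReal_lt_ofReal_iff_of_nonneg (mul_nonneg hβe.le hI), Real.rpow_neg hz'.le,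
    ← div_eq_mul_inv, lt_div_iff₀ (by positivity)]
  ring_nf

end HasNetworkLaw

/-- The indicator of the event that there is no outage, in terms of the legitimate nodes, the
selection variables, the eavesdroppers and the fading coefficients. -/
noncomputable def noOutage (Ξ : JammerPolicy) (α R₁ R₂ βe : ℝ)
    (p : ((ℕ × (ℕ → Plane)) × (ℕ → ℝ)) × ((ℕ × (ℕ → Plane)) × (Option ℕ → Option ℕ → ℝ))) : ℝ :=
  ∏ j ∈ Finset.range p.2.1.1, (1 -
    if ∑ i ∈ Finset.range p.1.1.1, Ξ.jamIte α R₁ R₂ 0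
      (p.2.2 (some i) (some j) *
        (βe * ‖p.2.1.2 j‖ ^ α * ‖p.1.1.2 i - p.2.1.2 j‖ ^ (-α))) (p.1.1.2 i) (p.1.2 i) <
      p.2.2 none (some j) then (1 : ℝ) else 0)

theorem measurable_noOutage (Ξ : JammerPolicy) (α R₁ R₂ βe : ℝ) :
    Measurable (noOutage Ξ α R₁ R₂ βe) := by
  refine measurable_prod_range (by fun_prop) fun j => ?_
  refine (measurable_ite_lt_one_zero ?_ (by fun_prop)).const_sub 1
  refine measurable_sum_range (by fun_prop) fun i => ?_
  exact Ξ.measurable_jamIte α R₁ R₂ 0 (by fun_prop) (by fun_prop) (by fun_prop)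

theorem norm_noOutage_le (Ξ : JammerPolicy) (α R₁ R₂ βe : ℝ) (p) :
    ‖noOutage Ξ α R₁ R₂ βe p‖ ≤ 1 := by
  unfold noOutage
  rw [Real.norm_of_nonneg (Finset.prod_nonneg fun j _ => by split_ifs <;> simp)]
  exact Finset.prod_le_one (fun j _ => by split_ifs <;> simp) fun j _ => by split_ifs <;> simp

theorem noOutage_eq {Ω : Type*} (net : FriendshipNetwork Ω) (Ξ : JammerPolicy) (α R₁ R₂ βe : ℝ)
    (ω ω' ω'' : Ω) :
    noOutage Ξ α R₁ R₂ βe ((net.nodeBlock ω, net.selBlock ω),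
      (net.eveBlock ω', net.fadeBlock ω'')) =
      ∏ j ∈ Finset.range (net.numEves ω'), (1 - if ∑ i ∈ net.jammers Ξ α R₁ R₂ ω,
        net.fade (some i) (some j) ω'' *
        (βe * ‖net.eve j ω'‖ ^ α * ‖net.node i ω - net.eve j ω'‖ ^ (-α)) <
          net.fade none (some j) ω'' then (1 : ℝ) else 0) := by
  simp_rw [sum_jammers]
  rfl

namespace HasNetworkLaw

variable {Ω : Type*} {net : FriendshipNetwork Ω} {Ξ : JammerPolicy} {α R₁ R₂ : ℝ}
  [MeasurableSpace Ω] {P : Measure Ω} {lam lamE D : ℝ}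

theorem compl_secrecyOutage_eq (h : net.HasNetworkLaw P lam lamE D) {βe : ℝ} (hβe : 0 < βe) :
    P.real (net.secrecyOutage Ξ α R₁ R₂ βe)ᶜ = ∫ ω,
      noOutage Ξ α R₁ R₂ βe ((net.nodeBlock ω, net.selBlock ω), (net.eveBlock ω, net.fadeBlock ω)) ∂P := by
  rw [← integral_indicator_one (h.measurableSet_secrecyOutage βe).compl]
  refine integral_congr_ae ?_
  have hz := h.eves_poisson.ae_forall_notMem (measurableSet_singleton 0) (by simp)
  filter_upwards [h.ae_fade_nonneg, hz] with ω hf hz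
  rw [noOutage_eq]
  by_cases ho : ω ∈ net.secrecyOutage Ξ α R₁ R₂ βe
  · obtain ⟨j, hj, hjo⟩ := ho
    rw [Set.indicator_of_notMem (by simpa using ⟨j, hj, hjo⟩)]
    refine (Finset.prod_eq_zero (Finset.mem_range.2 hj) ?_).symm
    rw [if_pos ((lt_eveSIR_iff hβe hf (hz j hj)).1 hjo), sub_self]
  · rw [Set.indicator_of_mem (by simpa using ho)]
    refine (Finset.prod_eq_one fun j hj => ?_).symm
    have hj := Finset.mem_range.1 hj
    rw [if_neg, sub_zero]
    exact fun hjo => ho ⟨j, hj, (lt_eveSIR_iff hβe hf (hz j hj)).2 hjo⟩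

/-- With the jammers frozen, the fading is integrated column by column, one column per eavesdropper.
The generating functional of the eavesdropper process is then applied to `1 - condLaplace`. -/
theorem integral_noOutage [IsProbabilityMeasure P] (h : net.HasNetworkLaw P lam lamE D) {βe : ℝ} (hβe : 0 < βe) (ω : Ω) :
    ∫ ω', noOutage Ξ α R₁ R₂ βe ((net.nodeBlock ω, net.selBlock ω),
      (net.eveBlock ω', net.fadeBlock ω')) ∂P = Real.exp
      (-∫ z, net.condLaplace Ξ α R₁ R₂ (βe * ‖z‖ ^ α) z ω ∂(ENNReal.ofReal lamE •
        (volume : Measure Plane).restrict (Metric.closedBall 0 D))) := by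
  have : IsFiniteMeasure ((volume : Measure Plane).restrict (Metric.closedBall 0 D)) :=
    isFiniteMeasure_restrict.2 measure_closedBall_lt_top.ne
  have : IsFiniteMeasure (ENNReal.ofReal lamE •
      (volume : Measure Plane).restrict (Metric.closedBall 0 D)) :=
    Measure.smul_finite _ ENNReal.ofReal_ne_top
  rw [IndepFun.integral_prodMk h.indepFun_eveBlock_fadeBlock h.measurable_eveBlock
    h.measurable_fadeBlock (G := fun q => noOutage Ξ α R₁ R₂ βe ((net.nodeBlock ω, net.selBlock ω), q))
    ((measurable_noOutage _ _ _ _ _).comp measurable_prodMk_left) (C := 1) fun q => norm_noOutage_le _ _ _ _ _ _]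
  have h3 : ∀ ω', ∫ ω'', noOutage Ξ α R₁ R₂ βe ((net.nodeBlock ω, net.selBlock ω),
      (net.eveBlock ω', net.fadeBlock ω'')) ∂P = ∏ j ∈ Finset.range (net.numEves ω'),
        (1 - net.condLaplace Ξ α R₁ R₂ (βe * ‖net.eve j ω'‖ ^ α) (net.eve j ω') ω) := by
    intro ω'
    simp_rw [noOutage_eq, condLaplace_eq_prod_jammers]
    exact integral_prod_ite_sum_lt h.indep_fade h.measurable_fade h.law_fade
      (net.jammers Ξ α R₁ R₂ ω) (c := fun i j => βe * ‖net.eve j ω'‖ ^ α *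
        ‖net.node i ω - net.eve j ω'‖ ^ (-α)) (fun i j => by positivity) _
  refine (integral_congr_ae (Filter.Eventually.of_forall h3)).trans ?_
  have hc : ∀ z, net.condLaplace Ξ α R₁ R₂ (βe * ‖z‖ ^ α) z ω ∈ Set.Icc (0 : ℝ) 1 := fun z =>
    net.condLaplace_mem_Icc Ξ α R₁ R₂ (by positivity) z ω
  have hm : Measurable fun z => net.condLaplace Ξ α R₁ R₂ (βe * ‖z‖ ^ α) z ω :=
    Finset.measurable_fun_prod _ fun i _ => Ξ.measurable_jamFactor α R₁ R₂ (by fun_prop)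
      measurable_id measurable_const measurable_const
  have := IsPoissonPointProcess.integral_prod h.eves_poisson
    (f := fun z => 1 - net.condLaplace Ξ α R₁ R₂ (βe * ‖z‖ ^ α) z ω) (hm.const_sub 1)
    (fun z => sub_nonneg.2 (hc z).2) (fun z => sub_le_self 1 (hc z).1)
  simp only [sub_sub_cancel] at this
  exact this

/-- The secrecy outage probability, after averaging over the fading and the eavesdroppers. -/
theorem secrecyOutageProb_eq [IsProbabilityMeasure P] (h : net.HasNetworkLaw P lam lamE D) {βe : ℝ} (hβe : 0 < βe) :
    net.secrecyOutageProb Ξ α R₁ R₂ P βe = 1 - ∫ ω, Real.exp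
      (-∫ z, net.condLaplace Ξ α R₁ R₂ (βe * ‖z‖ ^ α) z ω ∂(ENNReal.ofReal lamE •
        (volume : Measure Plane).restrict (Metric.closedBall 0 D))) ∂P := by
  rw [secrecyOutageProb, ← sub_sub_self 1 (P.real _), ← probReal_compl_eq_one_sub
    (h.measurableSet_secrecyOutage βe), h.compl_secrecyOutage_eq hβe, IndepFun.integral_prodMk h.indepFun_blocks
    (h.measurable_nodeBlock.prodMk h.measurable_selBlock)
    (h.measurable_eveBlock.prodMk h.measurable_fadeBlock)
    (measurable_noOutage _ _ _ _ _) (norm_noOutage_le _ _ _ _ _)]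
  simp_rw [h.integral_noOutage hβe]

end HasNetworkLaw

end FriendshipNetwork

/-! ### Lower bound through the nearest point. -/

/-- Cut `[0, D]` into `n + 1` equal pieces: the total loss is at most `C D² / (n + 1)`, which tends
to `0`. This replaces monotonicity by derivatives where differentiability is not available
everywhere. -/
theorem le_of_forall_sub_ge_neg_mul_sq {F : ℝ → ℝ} {C D : ℝ} (hD : 0 ≤ D)
    (h : ∀ s t, 0 ≤ s → s ≤ t → t ≤ D → -(C * (t - s) ^ 2) ≤ F t - F s) : F 0 ≤ F D := by
  have h1 : ∀ n : ℕ, -(C * D ^ 2) * (1 / ((n : ℝ) + 1)) ≤ F D - F 0 := fun n => by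
    have hn : (0 : ℝ) < n + 1 := by positivity
    have e := Finset.sum_range_sub (fun k : ℕ => F (k * (D / (n + 1)))) (n + 1)
    have e1 : ((n + 1 : ℕ) : ℝ) * (D / (n + 1)) = D := by push_cast; field_simp
    simp only [e1, Nat.cast_zero, zero_mul] at e
    rw [← e]
    have : ∀ k ∈ Finset.range (n + 1), -(C * (D / (n + 1)) ^ 2) ≤
        F ((k + 1 : ℕ) * (D / (n + 1))) - F (k * (D / (n + 1))) := fun k hk => by
      have hd : 0 ≤ D / (n + 1) := by positivity
      have hk' : ((k + 1 : ℕ) : ℝ) ≤ (n + 1 : ℕ) := by exact_mod_cast Finset.mem_range.1 hk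
      have := h (k * (D / (n + 1))) ((k + 1 : ℕ) * (D / (n + 1))) (by positivity)
        (by push_cast; nlinarith)
        ((mul_le_mul_of_nonneg_right hk' hd).trans e1.le)
      convert this using 4
      push_cast; ring
    refine le_trans (le_of_eq ?_) (Finset.card_nsmul_le_sum _ _ _ this)
    rw [Finset.card_range, nsmul_eq_mul]
    push_cast
    field_simp
  have h2 := le_of_tendsto' (tendsto_one_div_add_atTop_nhds_zero_nat.const_mul (-(C * D ^ 2))) h1
  linarith

theorem volume_real_closedBall_plane {t : ℝ} (ht : 0 ≤ t) :
    (volume : Measure Plane).real (Metric.closedBall 0 t) = Real.pi * t ^ 2 := by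
  rw [measureReal_def, EuclideanSpace.volume_closedBall_fin_two]
  simp [ht, Real.pi_pos.le, mul_comm]

/-- Follows from `(1 - δ + δ²)(1 + δ) = 1 + δ³ ≥ 1` and `1 + δ ≤ exp δ`. -/
theorem exp_neg_le_one_sub_add_sq {δ : ℝ} (h : 0 ≤ δ) : Real.exp (-δ) ≤ 1 - δ + δ ^ 2 := by
  rw [Real.exp_neg, inv_le_comm₀ (Real.exp_pos _) (by nlinarith)]
  refine le_trans ?_ (Real.add_one_le_exp δ)
  rw [inv_le_comm₀ (by nlinarith) (by positivity), inv_le_iff_one_le_mul₀ (by positivity)]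
  nlinarith [pow_nonneg h 3]

/-- A lower bound for the probability `1 - exp (-∫ lam q)` that a thinned Poisson point process is
not empty, by the probability that the point closest to the origin is retained. -/
theorem integral_exp_neg_sq_le {q : Plane → ℝ} (hq : Measurable q)
    (hq' : ∀ z, q z ∈ Set.Icc (0 : ℝ) 1) {lam D : ℝ} (hlam : 0 ≤ lam) (hD : 0 ≤ D) :
    ∫ z in Metric.closedBall 0 D, lam * q z * Real.exp (-(lam * Real.pi * ‖z‖ ^ 2)) ≤
      1 - Real.exp (-∫ z in Metric.closedBall (0 : Plane) D, lam * q z) := by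
  let B : ℝ → Set Plane := fun t => Metric.closedBall 0 t
  have hB : ∀ t, MeasurableSet (B t) := fun t => measurableSet_closedBall
  have hBf : ∀ t, volume (B t) ≠ ⊤ := fun t => measure_closedBall_lt_top.ne
  let e : Plane → ℝ := fun z => Real.exp (-(lam * Real.pi * ‖z‖ ^ 2))
  have he : ∀ z, e z ∈ Set.Icc (0 : ℝ) 1 := fun z =>
    ⟨(Real.exp_pos _).le, Real.exp_le_one_iff.2 (by
      have := Real.pi_pos; rw [neg_nonpos]; positivity)⟩
  have hem : Measurable e := by fun_prop
  have i1 : ∀ S : Set Plane, volume S ≠ ⊤ → IntegrableOn (fun z => lam * q z) S := fun S hS => by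
    have : IsFiniteMeasure ((volume : Measure Plane).restrict S) := isFiniteMeasure_restrict.2 hS
    refine Integrable.of_bound (by fun_prop) lam (Filter.Eventually.of_forall fun z => ?_)
    rw [Real.norm_of_nonneg (mul_nonneg hlam (hq' z).1)]
    exact mul_le_of_le_one_right hlam (hq' z).2
  have i2 : ∀ S : Set Plane, volume S ≠ ⊤ → IntegrableOn (fun z => lam * q z * e z) S :=
    fun S hS => by
    refine (i1 S hS).mono' (by fun_prop) (Filter.Eventually.of_forall fun z => ?_)
    have := mul_nonneg hlam (hq' z).1
    rw [Real.norm_of_nonneg (mul_nonneg this (he z).1)]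
    exact mul_le_of_le_one_right this (he z).2
  let G : ℝ → ℝ := fun t => ∫ z in B t, lam * q z
  let H : ℝ → ℝ := fun t => ∫ z in B t, lam * q z * e z
  have hGs : ∀ s, 0 ≤ s → G s ≤ lam * Real.pi * s ^ 2 := fun s hs => by
    have : G s ≤ ∫ z in B s, lam := setIntegral_mono (i1 _ (hBf s)) (integrableOn_const (hBf s))
      fun z => mul_le_of_le_one_right hlam (hq' z).2
    rw [setIntegral_const, volume_real_closedBall_plane hs, smul_eq_mul] at this
    linarith
  have hG0 : ∀ s, 0 ≤ G s := fun s => setIntegral_nonneg (hB s) fun z _ =>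
    mul_nonneg hlam (hq' z).1
  -- Formally `1 - exp (-G) - H` has derivative `G' (exp (-G) - exp (-lam π t²))`, which is
  -- nonnegative because `G t ≤ lam π t²`. As `q` is only measurable, this is carried out on
  -- increments, with an error quadratic in the mass of the annulus.
  have key : ∀ s t, 0 ≤ s → s ≤ t → t ≤ D → -((lam * Real.pi * (2 * D)) ^ 2 * (t - s) ^ 2) ≤
      (1 - Real.exp (-G t) - H t) - (1 - Real.exp (-G s) - H s) := by
    intro s t hs hst htD
    have hsub : B s ⊆ B t := Metric.closedBall_subset_closedBall hst
    have hdf : volume (B t \ B s) ≠ ⊤ := measure_ne_top_of_subset Set.sdiff_subset (hBf t)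
    have d1 : ∫ z in B t \ B s, lam * q z = G t - G s :=
      setIntegral_sdiff (hB s) (i1 _ (hBf t)) hsub
    have d2 : ∫ z in B t \ B s, lam * q z * e z = H t - H s :=
      setIntegral_sdiff (hB s) (i2 _ (hBf t)) hsub
    have hδ0 : 0 ≤ G t - G s := d1 ▸ setIntegral_nonneg ((hB t).diff (hB s)) fun z _ =>
      mul_nonneg hlam (hq' z).1
    have hδ1 : G t - G s ≤ lam * Real.pi * (2 * D) * (t - s) := by
      have : ∫ z in B t \ B s, lam * q z ≤ ∫ z in B t \ B s, lam :=
        setIntegral_mono (i1 _ hdf) (integrableOn_const hdf)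
          fun z => mul_le_of_le_one_right hlam (hq' z).2
      rw [d1, setIntegral_const, measureReal_sdiff hsub (hB s) (hBf t),
        volume_real_closedBall_plane hs, volume_real_closedBall_plane (hs.trans hst),
        smul_eq_mul] at this
      refine this.trans ?_
      have h1 : 0 ≤ lam * Real.pi * (t - s) :=
        mul_nonneg (mul_nonneg hlam Real.pi_pos.le) (sub_nonneg.2 hst)
      nlinarith [mul_le_mul_of_nonneg_left (show t + s ≤ 2 * D by linarith) h1]
    -- On the annulus `‖z‖ > s`, so `e z ≤ exp (-lam π s²) ≤ exp (-G s)`.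
    have hH : H t - H s ≤ Real.exp (-G s) * (G t - G s) := by
      rw [← d1, ← d2, ← integral_const_mul]
      refine setIntegral_mono_on (i2 _ hdf) ((i1 _ hdf).const_mul _) ((hB t).diff (hB s))
        fun z hz => ?_
      rw [mul_comm]
      refine mul_le_mul_of_nonneg_right (Real.exp_le_exp.2 (neg_le_neg ?_))
        (mul_nonneg hlam (hq' z).1)
      refine (hGs s hs).trans ?_
      have : s < ‖z‖ := by simpa [B] using hz.2
      have := Real.pi_pos
      gcongr
    have h2 : Real.exp (-G t) = Real.exp (-G s) * Real.exp (-(G t - G s)) := by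
      rw [← Real.exp_add]; ring_nf
    have h3 := exp_neg_le_one_sub_add_sq hδ0
    have h4 : Real.exp (-G s) ≤ 1 := Real.exp_le_one_iff.2 (neg_nonpos.2 (hG0 s))
    have h5 : (G t - G s) ^ 2 ≤ (lam * Real.pi * (2 * D) * (t - s)) ^ 2 := by gcongr
    have h6 := mul_le_mul_of_nonneg_left h3 (Real.exp_pos (-G s)).le
    have h7 := mul_le_mul_of_nonneg_right h4 (sq_nonneg (G t - G s))
    rw [h2]
    nlinarith
  have h := le_of_forall_sub_ge_neg_mul_sq (F := fun t => 1 - Real.exp (-G t) - H t) hD key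
  have hz : (volume : Measure Plane).restrict (B 0) = 0 := by
    rw [Measure.restrict_eq_zero]; simp [B]
  have hG : G 0 = 0 := by simp only [G, hz, integral_zero_measure]
  have hH : H 0 = 0 := by simp only [H, hz, integral_zero_measure]
  simp only [hG, hH, neg_zero, Real.exp_zero, sub_self] at h
  exact sub_nonneg.1 h

/-! ### Averaging over the jammers; the two bounds. -/

theorem setIntegral_closedBall_fun_norm (f : ℝ → ℝ) {D : ℝ} (hD : 0 ≤ D) :
    ∫ z in Metric.closedBall (0 : Plane) D, f ‖z‖ = ∫ r in (0 : ℝ)..D, 2 * Real.pi * r * f r := by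
  have h1 : ∫ z in Metric.closedBall (0 : Plane) D, f ‖z‖ =
      ∫ z : Plane, (Set.Iic D).indicator f ‖z‖ := by
    rw [← integral_indicator measurableSet_closedBall]
    congr 1 with z
    by_cases hz : ‖z‖ ≤ D <;> simp [hz]
  rw [h1, integral_fun_norm_addHaar volume ((Set.Iic D).indicator f),
    intervalIntegral.integral_of_le hD]
  have h2 : (volume : Measure Plane).real (Metric.ball 0 1) = Real.pi := by
    rw [measureReal_def, EuclideanSpace.volume_ball_fin_two]
    simp [Real.pi_pos.le]
  have h3 : ∀ y : ℝ, y ^ (Module.finrank ℝ Plane - 1) • (Set.Iic D).indicator f y =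
      (Set.Iic D).indicator (fun r => r * f r) y := fun y => by
    simp [Set.indicator_apply]
  simp_rw [h3]
  rw [setIntegral_indicator measurableSet_Iic, h2, Set.Ioi_inter_Iic]
  simp_rw [mul_assoc (2 * Real.pi)]
  rw [integral_const_mul]
  simp [mul_assoc]

namespace JammerPolicy

/-- The probability that a legitimate node at distance `r` is a jammer. -/
noncomputable def jamProb (Ξ : JammerPolicy) (α R₁ R₂ r : ℝ) : ℝ :=
  if r ≤ R₁ then 1 else if r ≤ R₂ then Ξ.prob α R₁ R₂ r else 0

variable (Ξ : JammerPolicy) (α R₁ R₂ : ℝ)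

theorem measurable_jamProb : Measurable fun r => Ξ.jamProb α R₁ R₂ r :=
  Measurable.ite measurableSet_Iic measurable_const
    (Measurable.ite measurableSet_Iic (Ξ.measurable_prob α R₁ R₂) measurable_const)

variable {α R₁ R₂}

theorem jamProb_mem_Icc (hα : 0 ≤ α) (hR₁ : 0 < R₁) (r : ℝ) :
    Ξ.jamProb α R₁ R₂ r ∈ Set.Icc (0 : ℝ) 1 := by
  unfold jamProb
  split_ifs with h1 h2
  · simp
  · exact Ξ.prob_mem_Icc hα hR₁ (not_le.1 h1) h2
  · simp

/-- Independent thinning: a uniform mark falls below the selection probability with exactly that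
probability. -/
theorem integral_jamFactor (hα : 0 ≤ α) (hR₁ : 0 < R₁) (t : ℝ) (z x : Plane) :
    ∫ v in Set.Icc (0 : ℝ) 1, Ξ.jamFactor α R₁ R₂ t z x v =
      1 - Ξ.jamProb α R₁ R₂ ‖x‖ * (1 - 1 / (1 + t * ‖x - z‖ ^ (-α))) := by
  set c := 1 / (1 + t * ‖x - z‖ ^ (-α)) with hc
  by_cases h1 : ‖x‖ ≤ R₁
  · have : ∀ v, Ξ.jamFactor α R₁ R₂ t z x v = c := fun v => by
      simp [jamFactor, jamIte, IsJammer, h1, hc]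
    simp [this, jamProb, h1]
  by_cases h2 : ‖x‖ ≤ R₂
  · have hp := Ξ.prob_mem_Icc hα hR₁ (not_le.1 h1) h2
    have : ∀ v, Ξ.jamFactor α R₁ R₂ t z x v =
        1 - (Set.Iic (Ξ.prob α R₁ R₂ ‖x‖)).indicator (fun _ => 1 - c) v := fun v => by
      by_cases hv : v ≤ Ξ.prob α R₁ R₂ ‖x‖ <;>
        simp [jamFactor, jamIte, IsJammer, h1, h2, hc, hv, not_le.1 h1]
    simp_rw [this]
    rw [integral_sub (integrable_const _)
      ((integrable_const _).indicator measurableSet_Iic), setIntegral_indicator measurableSet_Iic]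
    have hI : Set.Icc (0 : ℝ) 1 ∩ Set.Iic (Ξ.prob α R₁ R₂ ‖x‖) =
        Set.Icc 0 (Ξ.prob α R₁ R₂ ‖x‖) := by
      ext v
      simp only [Set.mem_inter_iff, Set.mem_Icc, Set.mem_Iic]
      exact ⟨fun h => ⟨h.1.1, h.2⟩, fun h => ⟨⟨h.1, h.2.trans hp.2⟩, h.2⟩⟩
    rw [hI]
    simp [jamProb, h1, h2, hp.1]
  · have : ∀ v, Ξ.jamFactor α R₁ R₂ t z x v = 1 := fun v => by
      simp [jamFactor, jamIte, IsJammer, h1, h2]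
    simp [this, jamProb, h1, h2]

end JammerPolicy

namespace FriendshipNetwork.HasNetworkLaw

variable {Ω : Type*} {net : FriendshipNetwork Ω} {Ξ : JammerPolicy} {α R₁ R₂ : ℝ}
  [MeasurableSpace Ω] {P : Measure Ω} [IsProbabilityMeasure P] {lam lamE D : ℝ}

/-- The selection marks are integrated first, at fixed nodes, which leaves one deterministic factor
per node; the generating functional of the nodes does the rest. -/
theorem integral_condLaplace (h : net.HasNetworkLaw P lam lamE D) (hlam : 0 ≤ lam) (hα : 0 ≤ α)
    (hR₁ : 0 < R₁) {t : ℝ} (ht : 0 ≤ t) (z : Plane) :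
    ∫ ω, net.condLaplace Ξ α R₁ R₂ t z ω ∂P =
      Real.exp (-(lam * ∫ x in Metric.closedBall (0 : Plane) D,
        Ξ.jamProb α R₁ R₂ ‖x‖ * (1 - 1 / (1 + t * ‖x - z‖ ^ (-α))))) := by
  have : IsFiniteMeasure ((volume : Measure Plane).restrict (Metric.closedBall 0 D)) :=
    isFiniteMeasure_restrict.2 measure_closedBall_lt_top.ne
  have : IsFiniteMeasure (ENNReal.ofReal lam •
      (volume : Measure Plane).restrict (Metric.closedBall 0 D)) :=
    Measure.smul_finite _ ENNReal.ofReal_ne_top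
  let G : (ℕ × (ℕ → Plane)) × (ℕ → ℝ) → ℝ := fun p =>
    ∏ i ∈ Finset.range p.1.1, Ξ.jamFactor α R₁ R₂ t z (p.1.2 i) (p.2 i)
  have hG : Measurable G := measurable_prod_range (by fun_prop) fun i =>
    Ξ.measurable_jamFactor α R₁ R₂ measurable_const measurable_const (by fun_prop) (by fun_prop)
  have hc := fun x v => Ξ.jamFactor_mem_Icc α R₁ R₂ ht z x v
  have hGb : ∀ p, ‖G p‖ ≤ 1 := fun p => by
    rw [Real.norm_of_nonneg (Finset.prod_nonneg fun i _ => (hc _ _).1)]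
    exact Finset.prod_le_one (fun i _ => (hc _ _).1) fun i _ => (hc _ _).2
  let f : Plane → ℝ := fun x => 1 - Ξ.jamProb α R₁ R₂ ‖x‖ * (1 - 1 / (1 + t * ‖x - z‖ ^ (-α)))
  have hf : Measurable f := by
    have := (Ξ.measurable_jamProb α R₁ R₂).comp (measurable_norm (α := Plane))
    exact (this.mul (by fun_prop)).const_sub 1
  have h1 : ∀ ω, ∫ ω', G (net.nodeBlock ω, net.selBlock ω') ∂P =
      ∏ i ∈ Finset.range (net.numNodes ω), f (net.node i ω) := fun ω => by
    have hm : ∀ i, Measurable fun v => Ξ.jamFactor α R₁ R₂ t z (net.node i ω) v := fun i =>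
      Ξ.measurable_jamFactor α R₁ R₂ measurable_const measurable_const measurable_const
        measurable_id
    have := iIndepFun.integral_prod_finset h.indep_sel h.measurable_sel
      (Finset.range (net.numNodes ω))
      (f := fun i v => Ξ.jamFactor α R₁ R₂ t z (net.node i ω) v) hm
    refine this.trans (Finset.prod_congr rfl fun i _ => ?_)
    refine Eq.trans ?_ (Ξ.integral_jamFactor hα hR₁ t z _)
    rw [← h.law_sel i, integral_map
      (h.measurable_sel i).aemeasurable (hm i).aestronglyMeasurable]
  have h2 : ∫ ω, net.condLaplace Ξ α R₁ R₂ t z ω ∂P =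
      ∫ ω, G (net.nodeBlock ω, net.selBlock ω) ∂P := rfl
  rw [h2, IndepFun.integral_prodMk h.indepFun_nodeBlock_selBlock h.measurable_nodeBlock
    h.measurable_selBlock hG hGb]
  simp_rw [h1]
  have hk : ∀ x : Plane, 1 - 1 / (1 + t * ‖x - z‖ ^ (-α)) ∈ Set.Icc (0 : ℝ) 1 := fun x => by
    have h0 : 0 ≤ t * ‖x - z‖ ^ (-α) := by positivity
    exact ⟨sub_nonneg.2 (div_le_one_of_le₀ (by linarith) (by linarith)),
      sub_le_self 1 (by positivity)⟩
  have hp := Ξ.jamProb_mem_Icc (R₂ := R₂) hα hR₁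
  rw [h.nodes_poisson.integral_prod hf
    (fun x => sub_nonneg.2 (mul_le_one₀ (hp _).2 (hk x).1 (hk x).2))
    (fun x => sub_le_self 1 (mul_nonneg (hp _).1 (hk x).1)), integral_smul_measure,
    ENNReal.toReal_ofReal hlam]
  simp only [f, sub_sub_cancel, smul_eq_mul]

/-- The reflection in the bisector of `z` and `w` takes `z` to `w` and preserves the disk, the
measure and `‖x‖`. -/
theorem integral_condLaplace_eq_of_norm_eq (h : net.HasNetworkLaw P lam lamE D) (hlam : 0 ≤ lam)
    (hα : 0 ≤ α) (hR₁ : 0 < R₁) {t : ℝ} (ht : 0 ≤ t) {z w : Plane}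
    (hzw : ‖z‖ = ‖w‖) :
    ∫ ω, net.condLaplace Ξ α R₁ R₂ t z ω ∂P = ∫ ω, net.condLaplace Ξ α R₁ R₂ t w ω ∂P := by
  rw [h.integral_condLaplace hlam hα hR₁ ht, h.integral_condLaplace hlam hα hR₁ ht]
  let φ : Plane ≃ₗᵢ[ℝ] Plane := (ℝ ∙ (z - w))ᗮ.reflection
  have hφ : φ z = w := Submodule.reflection_sub hzw
  have e := φ.measurePreserving.setIntegral_preimage_emb φ.toMeasurableEquiv.measurableEmbedding
    (fun x => Ξ.jamProb α R₁ R₂ ‖x‖ * (1 - 1 / (1 + t * ‖x - w‖ ^ (-α))))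
    (Metric.closedBall 0 D)
  have hb : φ ⁻¹' Metric.closedBall 0 D = Metric.closedBall 0 D := by
    ext x; simp
  rw [hb] at e
  rw [← e, ← hφ]
  simp_rw [← map_sub, LinearIsometryEquiv.norm_map]

/-- The Laplace transform of the interference at an arbitrary location, at the parameter that is
relevant for the outage there. -/
theorem integral_condLaplace_eq_laplaceInterference (h : net.HasNetworkLaw P lam lamE D)
    (hlam : 0 ≤ lam) (hα : 0 ≤ α) (hR₁ : 0 < R₁) {βe : ℝ} (hβe : 0 ≤ βe)
    {u : Plane} (hu : ‖u‖ = 1) (z : Plane) :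
    ∫ ω, net.condLaplace Ξ α R₁ R₂ (βe * ‖z‖ ^ α) z ω ∂P =
      net.laplaceInterference Ξ α R₁ R₂ P (‖z‖ • u) (βe * ‖z‖ ^ α) := by
  rw [h.laplaceInterference_eq _ (by positivity)]
  exact h.integral_condLaplace_eq_of_norm_eq hlam hα hR₁ (by positivity)
    (by rw [norm_smul, hu]; simp)

theorem integrable_condLaplace (h : net.HasNetworkLaw P lam lamE D) {βe : ℝ} (hβe : 0 ≤ βe) :
    Integrable (fun p : Ω × Plane => net.condLaplace Ξ α R₁ R₂ (βe * ‖p.2‖ ^ α) p.2 p.1)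
      (P.prod ((volume : Measure Plane).restrict (Metric.closedBall 0 D))) := by
  have : IsFiniteMeasure ((volume : Measure Plane).restrict (Metric.closedBall 0 D)) :=
    isFiniteMeasure_restrict.2 measure_closedBall_lt_top.ne
  refine Integrable.of_bound (h.measurable_condLaplace (t := fun z => βe * ‖z‖ ^ α)
    (by fun_prop)).aestronglyMeasurable 1 (Filter.Eventually.of_forall fun p => ?_)
  have := net.condLaplace_mem_Icc Ξ α R₁ R₂ (t := βe * ‖p.2‖ ^ α) (by positivity) p.2 p.1
  rw [Real.norm_of_nonneg this.1]
  exact this.2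

/-- Averaging over the jammers. -/
theorem integral_setIntegral_condLaplace (h : net.HasNetworkLaw P lam lamE D) (hlam : 0 ≤ lam)
    (hD : 0 ≤ D) (hα : 0 ≤ α) (hR₁ : 0 < R₁) {βe : ℝ}
    (hβe : 0 ≤ βe) {u : Plane} (hu : ‖u‖ = 1) {e : ℝ → ℝ} (he : Continuous e) :
    ∫ ω, (∫ z in Metric.closedBall (0 : Plane) D,
      net.condLaplace Ξ α R₁ R₂ (βe * ‖z‖ ^ α) z ω * e ‖z‖) ∂P =
    ∫ r in (0 : ℝ)..D, 2 * Real.pi * r *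
      (net.laplaceInterference Ξ α R₁ R₂ P (r • u) (βe * r ^ α) * e r) := by
  have hi : Integrable (fun p : Ω × Plane =>
      net.condLaplace Ξ α R₁ R₂ (βe * ‖p.2‖ ^ α) p.2 p.1 * e ‖p.2‖)
      (P.prod ((volume : Measure Plane).restrict (Metric.closedBall 0 D))) := by
    obtain ⟨C, hC⟩ := isCompact_Icc.exists_bound_of_continuousOn (s := Set.Icc 0 D) he.continuousOn
    refine (h.integrable_condLaplace hβe).mul_bdd (c := C)
      (he.measurable.comp (measurable_norm.comp measurable_snd)).aestronglyMeasurable ?_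
    have hm : MeasurableSet {p : Ω × Plane | ‖e ‖p.2‖‖ ≤ C} :=
      measurableSet_le ((he.measurable.comp (measurable_norm.comp measurable_snd)).norm)
        measurable_const
    rw [Measure.ae_prod_iff_ae_ae hm]
    refine Filter.Eventually.of_forall fun ω => ?_
    filter_upwards [ae_restrict_mem measurableSet_closedBall] with z hz
    exact hC _ ⟨norm_nonneg _, by simpa using hz⟩
  rw [integral_integral_swap (f := fun ω z =>
    net.condLaplace Ξ α R₁ R₂ (βe * ‖z‖ ^ α) z ω * e ‖z‖) hi]
  simp_rw [integral_mul_const,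
    h.integral_condLaplace_eq_laplaceInterference hlam hα hR₁ hβe hu]
  exact setIntegral_closedBall_fun_norm (fun r =>
    net.laplaceInterference Ξ α R₁ R₂ P (r • u) (βe * r ^ α) * e r) hD

theorem secrecyOutageProb_eq_setIntegral (h : net.HasNetworkLaw P lam lamE D) (hlamE : 0 ≤ lamE)
    {βe : ℝ} (hβe : 0 < βe) :
    net.secrecyOutageProb Ξ α R₁ R₂ P βe = 1 - ∫ ω, Real.exp
      (-(lamE * ∫ z in Metric.closedBall (0 : Plane) D,
        net.condLaplace Ξ α R₁ R₂ (βe * ‖z‖ ^ α) z ω)) ∂P := by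
  simp_rw [h.secrecyOutageProb_eq hβe, integral_smul_measure, ENNReal.toReal_ofReal hlamE,
    smul_eq_mul]

theorem integrable_exp_neg_condLaplace (h : net.HasNetworkLaw P lam lamE D) (hlamE : 0 ≤ lamE)
    {βe : ℝ} (hβe : 0 ≤ βe) :
    Integrable (fun ω => Real.exp (-(lamE * ∫ z in Metric.closedBall (0 : Plane) D,
        net.condLaplace Ξ α R₁ R₂ (βe * ‖z‖ ^ α) z ω))) P := by
  have h1 := (h.integrable_condLaplace (Ξ := Ξ) (α := α) (R₁ := R₁) (R₂ := R₂)
    hβe).integral_prod_left.aestronglyMeasurable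
  refine Integrable.of_bound (Real.continuous_exp.comp_aestronglyMeasurable
    (h1.const_mul lamE).neg) 1 (Filter.Eventually.of_forall fun ω => ?_)
  rw [Real.norm_of_nonneg (Real.exp_pos _).le, Real.exp_le_one_iff, neg_nonpos]
  exact mul_nonneg hlamE (integral_nonneg fun z =>
    (net.condLaplace_mem_Icc Ξ α R₁ R₂ (by positivity) z ω).1)

/-- Jensen's inequality, through the tangent of `exp (-x)` at the mean `m`: `exp (-X) ≥ exp (-m) (1
+ m - X)`, and the right side has mean `exp (-m)`. -/
theorem secrecyOutageProb_le (h : net.HasNetworkLaw P lam lamE D) (hlam : 0 ≤ lam)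
    (hlamE : 0 ≤ lamE) (hD : 0 ≤ D) (hα : 0 ≤ α) (hR₁ : 0 < R₁) {βe : ℝ}
    (hβe : 0 < βe) {u : Plane} (hu : ‖u‖ = 1) :
    net.secrecyOutageProb Ξ α R₁ R₂ P βe ≤ 1 - Real.exp (-(2 * Real.pi * lamE *
      ∫ r in (0 : ℝ)..D, net.laplaceInterference Ξ α R₁ R₂ P (r • u) (βe * r ^ α) * r)) := by
  have e1 := h.integral_setIntegral_condLaplace (Ξ := Ξ) (R₂ := R₂) hlam hD hα hR₁ hβe.le hu
    (e := fun _ => 1) continuous_const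
  simp only [mul_one] at e1
  have e2 : 2 * Real.pi * lamE * ∫ r in (0 : ℝ)..D,
      net.laplaceInterference Ξ α R₁ R₂ P (r • u) (βe * r ^ α) * r =
      ∫ ω, (lamE * ∫ z in Metric.closedBall (0 : Plane) D,
        net.condLaplace Ξ α R₁ R₂ (βe * ‖z‖ ^ α) z ω) ∂P := by
    rw [integral_const_mul, e1, ← intervalIntegral.integral_const_mul,
      ← intervalIntegral.integral_const_mul]
    congr 1 with r
    ring
  rw [h.secrecyOutageProb_eq_setIntegral hlamE hβe, e2]
  have hint := ((h.integrable_condLaplace (Ξ := Ξ) (α := α) (R₁ := R₁) (R₂ := R₂)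
    hβe.le).integral_prod_left).const_mul lamE
  set X : Ω → ℝ := fun ω => lamE * ∫ z in Metric.closedBall (0 : Plane) D,
        net.condLaplace Ξ α R₁ R₂ (βe * ‖z‖ ^ α) z ω with hX
  set m := ∫ ω, X ω ∂P with hm
  have e3 : ∫ ω, Real.exp (-m) * (1 + m - X ω) ∂P = Real.exp (-m) := by
    rw [integral_const_mul, integral_sub (integrable_const _) hint, integral_const,
      probReal_univ, one_smul, add_sub_cancel_right, mul_one]
  have e4 : ∫ ω, Real.exp (-m) * (1 + m - X ω) ∂P ≤ ∫ ω, Real.exp (-X ω) ∂P := by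
    refine integral_mono (((integrable_const _).sub hint).const_mul _)
      (h.integrable_exp_neg_condLaplace hlamE hβe.le) fun ω => ?_
    have h1 : Real.exp (-X ω) = Real.exp (-m) * Real.exp (m - X ω) := by
      rw [← Real.exp_add]; ring_nf
    simp only
    rw [h1]
    refine mul_le_mul_of_nonneg_left ?_ (Real.exp_pos _).le
    linarith [Real.add_one_le_exp (m - X ω)]
  rw [e3] at e4
  exact sub_le_sub_left e4 1

/-- The nearest-point inequality is applied for each `ω` with `q = condLaplace`, then averaged. -/
theorem le_secrecyOutageProb (h : net.HasNetworkLaw P lam lamE D) (hlam : 0 ≤ lam)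
    (hlamE : 0 ≤ lamE) (hD : 0 ≤ D) (hα : 0 ≤ α) (hR₁ : 0 < R₁) {βe : ℝ}
    (hβe : 0 < βe) {u : Plane} (hu : ‖u‖ = 1) :
    (∫ r in (0 : ℝ)..D, 2 * lamE * Real.pi * r * Real.exp (-(lamE * Real.pi * r ^ 2)) *
      net.laplaceInterference Ξ α R₁ R₂ P (r • u) (βe * r ^ α)) ≤
        net.secrecyOutageProb Ξ α R₁ R₂ P βe := by
  have : IsFiniteMeasure ((volume : Measure Plane).restrict (Metric.closedBall 0 D)) :=
    isFiniteMeasure_restrict.2 measure_closedBall_lt_top.ne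
  have hc : ∀ ω z, net.condLaplace Ξ α R₁ R₂ (βe * ‖z‖ ^ α) z ω ∈ Set.Icc (0 : ℝ) 1 := fun ω z =>
    net.condLaplace_mem_Icc Ξ α R₁ R₂ (by positivity) z ω
  have hm : ∀ ω, Measurable fun z => net.condLaplace Ξ α R₁ R₂ (βe * ‖z‖ ^ α) z ω := fun ω =>
    Finset.measurable_fun_prod _ fun i _ => Ξ.measurable_jamFactor α R₁ R₂ (by fun_prop)
      measurable_id measurable_const measurable_const
  have e1 := h.integral_setIntegral_condLaplace (Ξ := Ξ) (R₂ := R₂) hlam hD hα hR₁ hβe.le hu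
    (e := fun r => lamE * Real.exp (-(lamE * Real.pi * r ^ 2))) (by fun_prop)
  have e2 : ∫ r in (0 : ℝ)..D, 2 * lamE * Real.pi * r * Real.exp (-(lamE * Real.pi * r ^ 2)) *
      net.laplaceInterference Ξ α R₁ R₂ P (r • u) (βe * r ^ α) =
      ∫ r in (0 : ℝ)..D, 2 * Real.pi * r *
        (net.laplaceInterference Ξ α R₁ R₂ P (r • u) (βe * r ^ α) *
          (lamE * Real.exp (-(lamE * Real.pi * r ^ 2)))) := by
    congr 1 with r
    ring
  have hexp := h.integrable_exp_neg_condLaplace (Ξ := Ξ) (α := α) (R₁ := R₁) (R₂ := R₂)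
    hlamE hβe.le
  rw [e2, ← e1, h.secrecyOutageProb_eq_setIntegral hlamE hβe]
  have e3 : 1 - ∫ ω, Real.exp (-(lamE * ∫ z in Metric.closedBall (0 : Plane) D,
        net.condLaplace Ξ α R₁ R₂ (βe * ‖z‖ ^ α) z ω)) ∂P =
      ∫ ω, (1 - Real.exp (-(lamE * ∫ z in Metric.closedBall (0 : Plane) D,
        net.condLaplace Ξ α R₁ R₂ (βe * ‖z‖ ^ α) z ω))) ∂P := by
    rw [integral_sub (integrable_const _) hexp, integral_const, probReal_univ, one_smul]
  rw [e3]
  refine integral_mono_of_nonneg (Filter.Eventually.of_forall fun ω => ?_)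
    ((integrable_const 1).sub hexp) (Filter.Eventually.of_forall fun ω => ?_)
  · exact integral_nonneg fun z => mul_nonneg (hc ω z).1 (by positivity)
  · have h1 := integral_exp_neg_sq_le (hm ω) (hc ω) hlamE hD
    simp only
    rw [← integral_const_mul]
    refine le_trans (le_of_eq ?_) h1
    congr 1 with z
    ring

end FriendshipNetwork.HasNetworkLaw

/-! ### Angular and radial integrals. -/

/-- The constant `W` is a square root of `c ^ 2 - b ^ 2`, chosen in the half plane of `c`. -/
theorem integral_inv_sub_mul_cos {c W : ℂ} {b : ℝ} (hW : W ^ 2 = c ^ 2 - (b : ℂ) ^ 2)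
    (hre : 0 < (c * (starRingEnd ℂ) W).re) :
    (∀ θ : ℝ, c - b * Complex.cos θ ≠ 0) ∧
      ∫ θ in (-Real.pi)..Real.pi, (c - b * Complex.cos θ)⁻¹ = 2 * Real.pi / W := by
  have hc0 : c ≠ 0 := by rintro rfl; simp at hre
  have hW0 : W ≠ 0 := by rintro rfl; simp at hre
  have hn : ‖c - W‖ < ‖c + W‖ := by
    have h1 : Complex.normSq (c - W) < Complex.normSq (c + W) := by
      rw [Complex.normSq_sub, Complex.normSq_add]; linarith
    rw [Complex.normSq_eq_norm_sq, Complex.normSq_eq_norm_sq] at h1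
    exact lt_of_pow_lt_pow_left₀ 2 (norm_nonneg _) h1
  have hs0 : c + W ≠ 0 := norm_pos_iff.1 ((norm_nonneg _).trans_lt hn)
  -- The root `(c - W) / b` of `b z² - 2 c z + b`, written so that `b = 0` is allowed. Since `|w|² =
  -- |c - W| / |c + W| < 1`, it lies inside the unit circle; for `b ≠ 0` the other root is `1 / w`.
  set w : ℂ := b / (c + W) with hw
  have hbw : (b : ℂ) = w * (c + W) := by rw [hw]; field_simp
  have hw2 : w ^ 2 * (c + W) = c - W := by
    rw [hw]; field_simp; linear_combination hW
  clear_value w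
  have hw1 : ‖w‖ < 1 := by
    have h1 : ‖w‖ ^ 2 * ‖c + W‖ = ‖c - W‖ := by rw [← norm_pow, ← norm_mul, hw2]
    have h2 : 0 < ‖c + W‖ := norm_pos_iff.2 hs0
    by_contra h3
    have h4 := one_le_pow₀ (not_lt.1 h3) (n := 2)
    nlinarith
  have he0 : ∀ θ : ℝ, Complex.exp (θ * Complex.I) ≠ 0 := fun θ => Complex.exp_ne_zero _
  have he1 : ∀ θ : ℝ, ‖Complex.exp (θ * Complex.I)‖ = 1 := Complex.norm_exp_ofReal_mul_I
  have hd1 : ∀ z : ℂ, ‖z‖ = 1 → z - w ≠ 0 := fun z hz h => by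
    rw [sub_eq_zero] at h; rw [← h, hz] at hw1; exact lt_irrefl _ hw1
  have hd2 : ∀ z : ℂ, ‖z‖ ≤ 1 → 1 - w * z ≠ 0 := fun z hz h => by
    have h1 : ‖w * z‖ = 1 := by rw [← sub_eq_zero.1 h, norm_one]
    rw [norm_mul] at h1
    nlinarith [norm_nonneg w, norm_nonneg z]
  have hden : ∀ θ : ℝ, 2 * Complex.exp (θ * Complex.I) * (c - b * Complex.cos θ) =
      (c + W) * ((Complex.exp (θ * Complex.I) - w) * (1 - w * Complex.exp (θ * Complex.I))) := by
    intro θ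
    have h1 := he0 θ
    rw [Complex.cos, neg_mul, Complex.exp_neg, hbw]
    field_simp
    linear_combination (-Complex.exp (θ * Complex.I)) * hw2
  have hne : ∀ θ : ℝ, c - b * Complex.cos θ ≠ 0 := fun θ h => by
    have h1 := hden θ
    rw [h, mul_zero] at h1
    exact mul_ne_zero hs0 (mul_ne_zero (hd1 _ (he1 θ)) (hd2 _ (he1 θ).le)) h1.symm
  refine ⟨hne, ?_⟩
  have hper : Function.Periodic (fun θ : ℝ => (c - b * Complex.cos θ)⁻¹) (2 * Real.pi) := fun θ => by
    simp only
    push_cast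
    rw [Complex.cos_add_two_pi]
  have e1 := hper.intervalIntegral_add_eq (-Real.pi) 0
  rw [show -Real.pi + 2 * Real.pi = Real.pi by ring, zero_add] at e1
  rw [e1]
  -- Partial fractions on the unit circle: the first term has its pole `w` inside, the second is
  -- holomorphic on the closed disk and integrates to `0`.
  have e2 : ∫ θ in (0 : ℝ)..2 * Real.pi, W * (c - b * Complex.cos θ)⁻¹ =
      ∫ θ in (0 : ℝ)..2 * Real.pi, deriv (circleMap 0 1) θ •
        (Complex.I⁻¹ * ((circleMap 0 1 θ - w)⁻¹ + w * (1 - w * circleMap 0 1 θ)⁻¹)) := by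
    congr 1 with θ
    have h1 := hd1 _ (he1 θ)
    have h2 := hd2 _ (he1 θ).le
    have h3 := hne θ
    have h4 := hden θ
    simp only [deriv_circleMap, circleMap, zero_add, Complex.ofReal_one, one_mul, smul_eq_mul]
    set e := Complex.exp (θ * Complex.I)
    have h5 : 2 * W = (c + W) * (1 - w ^ 2) := by linear_combination hw2
    have h6 : e * Complex.I * (Complex.I⁻¹ * ((e - w)⁻¹ + w * (1 - w * e)⁻¹)) =
        e * (1 - w ^ 2) / ((e - w) * (1 - w * e)) := by
      rw [mul_assoc, mul_inv_cancel_left₀ Complex.I_ne_zero, eq_div_iff (mul_ne_zero h1 h2)]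
      linear_combination e * (1 - w * e) * inv_mul_cancel₀ h1 +
        e * w * (e - w) * inv_mul_cancel₀ h2
    rw [h6, ← div_eq_mul_inv, div_eq_div_iff h3 (mul_ne_zero h1 h2)]
    refine mul_left_cancel₀ hs0 ?_
    linear_combination (-W) * h4 + (e * (c - b * Complex.cos θ)) * h5
  have e3 : ∮ z in C(0, 1), (z - w)⁻¹ = 2 * Real.pi * Complex.I :=
    circleIntegral.integral_sub_inv_of_mem_ball (by simpa using hw1)
  have hdiff : DifferentiableOn ℂ (fun z => w * (1 - w * z)⁻¹) (Metric.closedBall 0 1) :=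
    fun z hz => by
      have := hd2 z (by simpa using hz)
      exact DifferentiableAt.differentiableWithinAt (by fun_prop (disch := assumption))
  have e4 : ∮ z in C(0, 1), w * (1 - w * z)⁻¹ = 0 :=
    (DifferentiableOn.diffContOnCl_ball (U := Metric.closedBall 0 1) hdiff
      subset_rfl).circleIntegral_eq_zero zero_le_one
  have e5 : ∮ z in C(0, 1), Complex.I⁻¹ * ((z - w)⁻¹ + w * (1 - w * z)⁻¹) = 2 * Real.pi := by
    rw [circleIntegral.integral_const_mul, circleIntegral.integral_add, e3, e4]
    · field_simp; simp
    · refine ContinuousOn.circleIntegrable zero_le_one fun z hz => ?_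
      have := hd1 z (by simpa using hz)
      exact ContinuousAt.continuousWithinAt (by fun_prop (disch := assumption))
    · exact (hdiff.continuousOn.mono Metric.sphere_subset_closedBall).circleIntegrable zero_le_one
  rw [circleIntegral, ← e2, intervalIntegral.integral_const_mul] at e5
  rw [eq_div_iff hW0, mul_comm, e5]

theorem integral_inv_sub_mul_cos_real {c W b : ℝ} (hW : W ^ 2 = c ^ 2 - b ^ 2) (hc : 0 < c)
    (hW0 : 0 < W) :
    ∫ θ in (-Real.pi)..Real.pi, (c - b * Real.cos θ)⁻¹ = 2 * Real.pi / W := by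
  have h := (integral_inv_sub_mul_cos (c := c) (W := W) (b := b) (by exact_mod_cast hW)
    (by simpa using mul_pos hc hW0)).2
  have e : ∀ θ : ℝ, ((c : ℂ) - b * Complex.cos θ)⁻¹ = ((c - b * Real.cos θ)⁻¹ : ℝ) := fun θ => by
    push_cast; rfl
  simp_rw [e, intervalIntegral.integral_ofReal] at h
  exact_mod_cast h

/-- For real `x`, `σ / (σ² + x²)` is the imaginary part of `1 / (x - iσ)`. So this is the imaginary
part of the previous integral with `c = a - iσ` and `W = η - iψ`. -/
theorem integral_inv_add_sub_mul_cos_sq {a b σ η ψ : ℝ} (hσ : 0 < σ) (ha : 0 < a)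
    (h1 : η ^ 2 - ψ ^ 2 = a ^ 2 - σ ^ 2 - b ^ 2) (h2 : η * ψ = σ * a) (hη : 0 < η) (hψ : 0 < ψ) :
    ∫ θ in (-Real.pi)..Real.pi, (σ ^ 2 + (a - b * Real.cos θ) ^ 2)⁻¹ =
      2 * Real.pi / σ * (ψ / (η ^ 2 + ψ ^ 2)) := by
  have hW : ((η : ℂ) - ψ * Complex.I) ^ 2 = ((a : ℂ) - σ * Complex.I) ^ 2 - (b : ℂ) ^ 2 := by
    have h1' : (η : ℂ) ^ 2 - ψ ^ 2 = a ^ 2 - σ ^ 2 - b ^ 2 := by exact_mod_cast h1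
    have h2' : (η : ℂ) * ψ = σ * a := by exact_mod_cast h2
    linear_combination h1' - 2 * Complex.I * h2' + (ψ ^ 2 - σ ^ 2) * Complex.I_sq
  obtain ⟨hne, h⟩ := integral_inv_sub_mul_cos hW (by
    simp
    positivity)
  have hi : IntervalIntegrable (fun θ : ℝ => ((a : ℂ) - σ * Complex.I - b * Complex.cos θ)⁻¹)
      volume (-Real.pi) Real.pi :=
    (Continuous.inv₀ (by fun_prop) hne).intervalIntegrable _ _
  have h3 := Complex.imCLM.intervalIntegral_comp_comm hi
  rw [h] at h3
  have e : ∀ θ : ℝ, Complex.imCLM ((a : ℂ) - σ * Complex.I - b * Complex.cos θ)⁻¹ =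
      σ * (σ ^ 2 + (a - b * Real.cos θ) ^ 2)⁻¹ := fun θ => by
    rw [Complex.imCLM_apply, Complex.inv_im, ← Complex.ofReal_cos, Complex.normSq_apply]
    simp [Complex.cos_ofReal_re]
    ring
  simp_rw [e, intervalIntegral.integral_const_mul] at h3
  have e2 : Complex.imCLM (2 * Real.pi / ((η : ℂ) - ψ * Complex.I)) =
      2 * Real.pi * (ψ / (η ^ 2 + ψ ^ 2)) := by
    rw [Complex.imCLM_apply, div_eq_mul_inv]
    have : (2 : ℂ) * Real.pi = ((2 * Real.pi : ℝ) : ℂ) := by push_cast; rfl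
    rw [this, Complex.im_ofReal_mul, Complex.inv_im, Complex.normSq_apply]
    simp
    ring
  rw [e2] at h3
  field_simp at h3 ⊢
  linarith

/-- Polar coordinates for a radial function times a function of the distance to a point. -/
theorem setIntegral_closedBall_mul_norm_sub {ρ K : ℝ → ℝ} (hρ : Measurable ρ) (hK : Measurable K)
    (hρ' : ∀ r, ρ r ∈ Set.Icc (0 : ℝ) 1) (hK' : ∀ d, 0 ≤ d → K d ∈ Set.Icc (0 : ℝ) 1) {D : ℝ}
    (hD : 0 ≤ D) (y : ℝ) :
    ∫ x in Metric.closedBall (0 : Plane) D,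
      ρ ‖x‖ * K (‖x - Complex.orthonormalBasisOneI.repr (y : ℂ)‖ ^ 2) =
    ∫ r in (0 : ℝ)..D, ρ r *
      (r * ∫ θ in (-Real.pi)..Real.pi, K (r ^ 2 + y ^ 2 - 2 * r * y * Real.cos θ)) := by
  let φ := Complex.orthonormalBasisOneI.repr
  have e := φ.measurePreserving.setIntegral_preimage_emb φ.toMeasurableEquiv.measurableEmbedding
    (fun x => ρ ‖x‖ * K (‖x - φ (y : ℂ)‖ ^ 2)) (Metric.closedBall 0 D)
  have hb : φ ⁻¹' Metric.closedBall 0 D = Metric.closedBall 0 D := by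
    ext x; simp
  rw [hb] at e
  rw [← e]
  simp_rw [← map_sub, LinearIsometryEquiv.norm_map]
  rw [← integral_indicator measurableSet_closedBall, ← Complex.integral_comp_polarCoord_symm]
  let F : ℝ × ℝ → ℝ := fun p =>
    p.1 * (ρ p.1 * K (p.1 ^ 2 + y ^ 2 - 2 * p.1 * y * Real.cos p.2))
  have hn : ∀ r θ : ℝ, ‖Complex.polarCoord.symm (r, θ) - (y : ℂ)‖ ^ 2 =
      r ^ 2 + y ^ 2 - 2 * r * y * Real.cos θ := fun r θ => by
    rw [← Complex.normSq_eq_norm_sq, Complex.polarCoord_symm_apply, Complex.normSq_apply]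
    simp [Complex.cos_ofReal_re, Complex.sin_ofReal_re]
    linear_combination r ^ 2 * Real.cos_sq_add_sin_sq θ
  have e1 : ∀ p ∈ polarCoord.target, p.1 • (Metric.closedBall (0 : ℂ) D).indicator
      (fun z => ρ ‖z‖ * K (‖z - (y : ℂ)‖ ^ 2)) (Complex.polarCoord.symm p) =
      (Set.Iic D ×ˢ Set.univ).indicator F p := fun p hp => by
    obtain ⟨r, θ⟩ := p
    have hr : 0 < r := hp.1
    have hr' : ‖Complex.polarCoord.symm (r, θ)‖ = r := by
      rw [Complex.norm_polarCoord_symm, abs_of_pos hr]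
    by_cases h : r ≤ D
    · rw [Set.indicator_of_mem (by simpa only [mem_closedBall_zero_iff, hr'] using h),
        Set.indicator_of_mem (by simpa using h), hn, hr', smul_eq_mul]
    · rw [Set.indicator_of_notMem (by simpa only [mem_closedBall_zero_iff, hr'] using h),
        Set.indicator_of_notMem (by simpa using h), smul_zero]
  have ht : polarCoord.target ∩ (Set.Iic D ×ˢ Set.univ) = Set.Ioc 0 D ×ˢ Set.Ioo (-Real.pi) Real.pi := by
    rw [polarCoord_target, Set.prod_inter_prod, Set.inter_univ, Set.Ioi_inter_Iic]
  have hFm : Measurable F := by fun_prop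
  rw [setIntegral_congr_fun (polarCoord.open_target.measurableSet) e1,
    setIntegral_indicator (measurableSet_Iic.prod MeasurableSet.univ), ht,
    Measure.volume_eq_prod, setIntegral_prod]
  · rw [intervalIntegral.integral_of_le hD]
    refine integral_congr_ae (Filter.Eventually.of_forall fun r => ?_)
    simp only [F]
    rw [integral_const_mul, integral_const_mul, intervalIntegral.integral_of_le (by
      linarith [Real.pi_pos]), integral_Ioc_eq_integral_Ioo]
    ring
  · refine IntegrableOn.of_bound ?_ hFm.aestronglyMeasurable D ?_
    · rw [Measure.prod_prod]
      exact ENNReal.mul_lt_top (by simp) (by simp)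
    · filter_upwards [ae_restrict_mem (measurableSet_Ioc.prod measurableSet_Ioo)] with p hp
      have h0 : 0 < p.1 := hp.1.1
      have hd : 0 ≤ p.1 ^ 2 + y ^ 2 - 2 * p.1 * y * Real.cos p.2 := by
        rw [← hn]; positivity
      have h1 := hρ' p.1
      have h2 := hK' _ hd
      simp only [F]
      rw [Real.norm_of_nonneg (mul_nonneg h0.le (mul_nonneg h1.1 h2.1))]
      exact (mul_le_of_le_one_right h0.le (mul_le_one₀ h1.2 h2.1 h2.2)).trans hp.1.2

namespace JammerPolicy

/-- The mean of a radial function over the jammers, in terms of its antiderivatives. -/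
theorem integral_jamProb_mul (Ξ : JammerPolicy) {α R₁ R₂ D : ℝ} {n : ℕ} (hn : α = n)
    (hR₁ : 0 < R₁) (hR : R₁ ≤ R₂) (hRD : R₂ ≤ D) {k B M : ℝ → ℝ} (hk : Continuous k)
    (hB : ∀ r, HasDerivAt B (k r) r) (hM : ∀ r, HasDerivAt M (r ^ n * k r) r) :
    ∫ r in (0 : ℝ)..D, Ξ.jamProb α R₁ R₂ r * k r = B R₁ - B 0 + (match Ξ with
      | .E p => (p : ℝ) * (B R₂ - B R₁)
      | .I => (M R₂ - M R₁ - R₁ ^ n * (B R₂ - B R₁)) / (R₂ ^ n - R₁ ^ n)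
      | .D => (R₂ ^ n * (B R₂ - B R₁) - (M R₂ - M R₁)) / (R₂ ^ n - R₁ ^ n)) := by
  have hi : ∀ a b, IntervalIntegrable k volume a b := fun a b => hk.intervalIntegrable a b
  have hi' : ∀ a b, IntervalIntegrable (fun r => r ^ n * k r) volume a b := fun a b =>
    ((continuous_pow n).mul hk).intervalIntegrable a b
  have b1 : ∀ a b, ∫ r in a..b, k r = B b - B a := fun a b =>
    intervalIntegral.integral_eq_sub_of_hasDerivAt (fun r _ => hB r) (hi a b)
  have b2 : ∀ a b, ∫ r in a..b, r ^ n * k r = M b - M a := fun a b =>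
    intervalIntegral.integral_eq_sub_of_hasDerivAt (fun r _ => hM r) (hi' a b)
  have key : IntervalIntegrable (fun r => Ξ.prob α R₁ R₂ r * k r) volume R₁ R₂ ∧
      ∫ r in R₁..R₂, Ξ.prob α R₁ R₂ r * k r = (match Ξ with
      | .E p => (p : ℝ) * (B R₂ - B R₁)
      | .I => (M R₂ - M R₁ - R₁ ^ n * (B R₂ - B R₁)) / (R₂ ^ n - R₁ ^ n)
      | .D => (R₂ ^ n * (B R₂ - B R₁) - (M R₂ - M R₁)) / (R₂ ^ n - R₁ ^ n)) := by
    -- If `R₁ = R₂`, the denominators vanish and division by zero gives `0`, in agreement with the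
    -- empty annulus; no separate case is needed.
    cases Ξ with
    | E p =>
      simp only [prob]
      exact ⟨(hi _ _).const_mul _, by rw [intervalIntegral.integral_const_mul, b1]⟩
    | I =>
      have h : (fun r => JammerPolicy.I.prob α R₁ R₂ r * k r) = fun r =>
          (R₂ ^ n - R₁ ^ n)⁻¹ * (r ^ n * k r - R₁ ^ n * k r) := by
        ext r
        simp only [prob, hn, Real.rpow_natCast]
        ring
      rw [h, intervalIntegral.integral_const_mul,
        intervalIntegral.integral_sub (hi' _ _) ((hi _ _).const_mul _),
        intervalIntegral.integral_const_mul, b1, b2, inv_mul_eq_div]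
      exact ⟨((hi' _ _).sub ((hi _ _).const_mul _)).const_mul _, rfl⟩
    | D =>
      have h : (fun r => JammerPolicy.D.prob α R₁ R₂ r * k r) = fun r =>
          (R₂ ^ n - R₁ ^ n)⁻¹ * (R₂ ^ n * k r - r ^ n * k r) := by
        ext r
        simp only [prob, hn, Real.rpow_natCast]
        ring
      rw [h, intervalIntegral.integral_const_mul,
        intervalIntegral.integral_sub ((hi _ _).const_mul _) (hi' _ _),
        intervalIntegral.integral_const_mul, b1, b2, inv_mul_eq_div]
      exact ⟨(((hi _ _).const_mul _).sub (hi' _ _)).const_mul _, rfl⟩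
  have e1 : Set.EqOn (fun r => Ξ.jamProb α R₁ R₂ r * k r) k (Set.uIoc 0 R₁) := fun r hr => by
    rw [Set.uIoc_of_le hR₁.le] at hr
    simp [jamProb, hr.2]
  have e2 : Set.EqOn (fun r => Ξ.jamProb α R₁ R₂ r * k r)
      (fun r => Ξ.prob α R₁ R₂ r * k r) (Set.uIoc R₁ R₂) := fun r hr => by
    rw [Set.uIoc_of_le hR] at hr
    simp [jamProb, hr.2, not_le.2 hr.1]
  have e3 : Set.EqOn (fun r => Ξ.jamProb α R₁ R₂ r * k r) (fun _ => 0) (Set.uIoc R₂ D) :=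
    fun r hr => by
    rw [Set.uIoc_of_le hRD] at hr
    simp [jamProb, not_le.2 hr.1, not_le.2 (hR.trans_lt hr.1)]
  have i1 := (intervalIntegrable_congr e1.symm).1 (hi 0 R₁)
  have i2 := (intervalIntegrable_congr e2.symm).1 key.1
  have i3 := (intervalIntegrable_congr e3.symm).1 (_root_.intervalIntegrable_const (μ := volume) (a := R₂) (b := D) (c := (0 : ℝ)))
  rw [← intervalIntegral.integral_add_adjacent_intervals (i1.trans i2) i3,
    ← intervalIntegral.integral_add_adjacent_intervals i1 i2,
    intervalIntegral.integral_congr_ae (Filter.Eventually.of_forall fun r hr => e1 hr), intervalIntegral.integral_congr_ae (Filter.Eventually.of_forall fun r hr => e2 hr),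
    intervalIntegral.integral_congr_ae (Filter.Eventually.of_forall fun r hr => e3 hr), intervalIntegral.integral_zero, add_zero, b1, key.2]

end JammerPolicy

/-- Off the receiver, `1 - 1 / (1 + s d^(-2n)) = s / (s + (d²)^n)`, and the law of cosines expresses
`d²` through `cos θ`. -/
theorem FriendshipNetwork.HasNetworkLaw.laplaceInterference_eq_exp {Ω : Type*}
    [MeasurableSpace Ω] {P : Measure Ω} [IsProbabilityMeasure P] {net : FriendshipNetwork Ω}
    {Ξ : JammerPolicy} {α R₁ R₂ lam lamE D : ℝ} {n : ℕ} (h : net.HasNetworkLaw P lam lamE D)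
    (hlam : 0 ≤ lam) (hD : 0 ≤ D) (hn : α = 2 * n) (hR₁ : 0 < R₁) {s y : ℝ} (hs : 0 < s)
    {u : Plane} (hu : ‖u‖ = 1) :
    net.laplaceInterference Ξ α R₁ R₂ P (y • u) s = Real.exp (-(lam *
      ∫ r in (0 : ℝ)..D, Ξ.jamProb α R₁ R₂ r * (r * ∫ θ in (-Real.pi)..Real.pi,
        s / (s + (r ^ 2 + y ^ 2 - 2 * r * y * Real.cos θ) ^ n)))) := by
  have hα : 0 ≤ α := by rw [hn]; positivity
  have hz : ‖y • u‖ = ‖Complex.orthonormalBasisOneI.repr (y : ℂ)‖ := by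
    rw [norm_smul, hu, LinearIsometryEquiv.norm_map, Complex.norm_real, mul_one]
  rw [h.laplaceInterference_eq _ hs.le,
    h.integral_condLaplace_eq_of_norm_eq hlam hα hR₁ hs.le hz,
    h.integral_condLaplace hlam hα hR₁ hs.le]
  have e := setIntegral_closedBall_mul_norm_sub (Ξ.measurable_jamProb α R₁ R₂)
    (K := fun d => s / (s + d ^ n)) (by fun_prop) (Ξ.jamProb_mem_Icc hα hR₁)
    (fun d hd => ⟨by positivity, div_le_one_of_le₀ (by
      have := pow_nonneg hd n; linarith) (by positivity)⟩) hD y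
  rw [← e]
  congr 3
  refine integral_congr_ae (ae_restrict_of_ae ?_)
  -- At the receiver itself `0 ^ (-α)` is a convention, so this null set is discarded.
  have hne : ∀ᵐ x : Plane, x ≠ Complex.orthonormalBasisOneI.repr (y : ℂ) := by simp [ae_iff]
  filter_upwards [hne] with x hx
  have hd : 0 < ‖x - Complex.orthonormalBasisOneI.repr (y : ℂ)‖ := norm_sub_pos_iff.2 hx
  set d := ‖x - Complex.orthonormalBasisOneI.repr (y : ℂ)‖
  have h1 : d ^ (-α) = ((d ^ 2) ^ n)⁻¹ := by
    rw [Real.rpow_neg hd.le, hn, ← pow_mul, ← Real.rpow_natCast]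
    push_cast; rfl
  rw [h1]
  have h2 : 0 < (d ^ 2) ^ n := by positivity
  congr 1
  field_simp
  ring

/-! ### Path loss exponent 2. -/

section PathLossTwo

variable {s y : ℝ}

theorem hasDerivAt_arsinh_term (hs : 0 < s) (hy : 0 < y) (r : ℝ) :
    HasDerivAt (fun r => Real.arsinh ((s + r ^ 2 - y ^ 2) / (2 * y * √s)))
      (2 * r / √(r ^ 4 + 2 * (s - y ^ 2) * r ^ 2 + (s + y ^ 2) ^ 2)) r := by
  have hs' := Real.sqrt_pos.2 hs
  have h1 : HasDerivAt (fun r : ℝ => (s + r ^ 2 - y ^ 2) / (2 * y * √s))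
      (2 * r / (2 * y * √s)) r := by
    have := (((hasDerivAt_pow 2 r).const_add s).sub_const (y ^ 2)).div_const (2 * y * √s)
    simpa using this
  convert h1.arsinh using 1
  have h2 : r ^ 4 + 2 * (s - y ^ 2) * r ^ 2 + (s + y ^ 2) ^ 2 =
      (2 * y * √s) ^ 2 * (1 + ((s + r ^ 2 - y ^ 2) / (2 * y * √s)) ^ 2) := by
    have : (2 * y * √s) ^ 2 = 4 * y ^ 2 * s := by rw [mul_pow, Real.sq_sqrt hs.le]; ring
    rw [mul_add, ← mul_pow, mul_div_cancel₀ _ (by positivity), this]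
    ring
  rw [h2, Real.sqrt_mul (by positivity), Real.sqrt_sq (by positivity), smul_eq_mul]
  field_simp

theorem quartic_pos (hs : 0 < s) (hy : 0 < y) (r : ℝ) :
    0 < r ^ 4 + 2 * (s - y ^ 2) * r ^ 2 + (s + y ^ 2) ^ 2 := by
  have : r ^ 4 + 2 * (s - y ^ 2) * r ^ 2 + (s + y ^ 2) ^ 2 =
    (s + r ^ 2 - y ^ 2) ^ 2 + 4 * y ^ 2 * s := by ring
  rw [this]; positivity

theorem hasDerivAt_sqrt_quartic (hs : 0 < s) (hy : 0 < y) (r : ℝ) :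
    HasDerivAt (fun r => √(r ^ 4 + 2 * (s - y ^ 2) * r ^ 2 + (s + y ^ 2) ^ 2))
      (2 * r * (r ^ 2 + s - y ^ 2) /
        √(r ^ 4 + 2 * (s - y ^ 2) * r ^ 2 + (s + y ^ 2) ^ 2)) r := by
  have h1 := ((((hasDerivAt_pow 4 r).fun_add ((hasDerivAt_pow 2 r).const_mul
    (2 * (s - y ^ 2)))).add_const ((s + y ^ 2) ^ 2)).sqrt (quartic_pos hs hy r).ne')
  have h2 := Real.sqrt_pos.2 (quartic_pos hs hy r)
  convert h1 using 1
  field_simp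
  push_cast
  ring

/-- `sinh (log (√s / y)) = (√s / y - y / √s) / 2 = (s - y²) / (2 y √s)`. -/
theorem arsinh_term_zero (hs : 0 < s) (hy : 0 < y) :
    Real.arsinh ((s + 0 ^ 2 - y ^ 2) / (2 * y * √s)) = Real.log (√s / y) := by
  have hs' := Real.sqrt_pos.2 hs
  rw [← Real.arsinh_sinh (Real.log (√s / y)), Real.sinh_eq, Real.exp_neg,
    Real.exp_log (by positivity)]
  congr 1
  field_simp
  rw [Real.sq_sqrt hs.le]
  ring

end PathLossTwo

/-- The angular integral has `c = s + r² + y²` and `b = 2 r y`, and `c² - b²` is the quartic under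
the root in `Q`. -/
theorem FriendshipNetwork.HasNetworkLaw.laplaceInterference_two {Ω : Type*}
    [MeasurableSpace Ω] {P : Measure Ω} [IsProbabilityMeasure P] {net : FriendshipNetwork Ω}
    {Ξ : JammerPolicy} {R₁ R₂ lam lamE D : ℝ} (h : net.HasNetworkLaw P lam lamE D)
    (hlam : 0 ≤ lam) (hR₁ : 0 < R₁) (hR : R₁ ≤ R₂) (hRD : R₂ ≤ D) {s y : ℝ} (hs : 0 < s)
    (hy : 0 < y) {u : Plane} (hu : ‖u‖ = 1) :
    net.laplaceInterference Ξ 2 R₁ R₂ P (y • u) s = laplaceTwo lam R₁ R₂ s y Ξ := by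
  have hD : 0 ≤ D := hR₁.le.trans (hR.trans hRD)
  rw [h.laplaceInterference_eq_exp (n := 1) hlam hD (by norm_num) hR₁ hs hu]
  let Q : ℝ → ℝ := fun r => √(r ^ 4 + 2 * (s - y ^ 2) * r ^ 2 + (s + y ^ 2) ^ 2)
  let A : ℝ → ℝ := fun r => Real.arsinh ((s + r ^ 2 - y ^ 2) / (2 * y * √s))
  have hQ : ∀ r, 0 < Q r := fun r => Real.sqrt_pos.2 (quartic_pos hs hy r)
  have hang : ∀ r, r * ∫ θ in (-Real.pi)..Real.pi,
      s / (s + (r ^ 2 + y ^ 2 - 2 * r * y * Real.cos θ) ^ 1) =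
      Real.pi * s * (2 * r / Q r) := fun r => by
    have e : ∀ θ, s / (s + (r ^ 2 + y ^ 2 - 2 * r * y * Real.cos θ) ^ 1) =
        s * ((s + r ^ 2 + y ^ 2) - 2 * r * y * Real.cos θ)⁻¹ := fun θ => by
      rw [pow_one, div_eq_mul_inv]; ring_nf
    simp_rw [e, intervalIntegral.integral_const_mul]
    rw [integral_inv_sub_mul_cos_real (W := Q r) _ (by positivity) (hQ r)]
    · ring
    · rw [Real.sq_sqrt (quartic_pos hs hy r).le]; ring
  simp_rw [hang]
  have hcont : Continuous fun r => Real.pi * s * (2 * r / Q r) :=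
    (Continuous.div (by fun_prop) (by fun_prop) fun r => (hQ r).ne').const_mul _
  have hA := fun r => (hasDerivAt_arsinh_term hs hy r).const_mul (Real.pi * s)
  -- Found by splitting `r² = (r² + s - y²) - (s - y²)`: the first part integrates to `Q`, the
  -- second to a multiple of `A`.
  have hM : ∀ r, HasDerivAt (fun r => Real.pi * s * (Q r - (s - y ^ 2) * A r))
      (r ^ 2 * (Real.pi * s * (2 * r / Q r))) r := fun r => by
    refine (((hasDerivAt_sqrt_quartic hs hy r).fun_sub
      ((hasDerivAt_arsinh_term hs hy r).const_mul (s - y ^ 2))).const_mul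
        (Real.pi * s)).congr_deriv ?_
    have := hQ r
    simp only [Q] at this ⊢
    field_simp
    ring
  rw [Ξ.integral_jamProb_mul (n := 2) (by norm_num) hR₁ hR hRD hcont hA hM,
    arsinh_term_zero hs hy]
  cases Ξ with
  | E p =>
    simp only [laplaceTwo]
    congr 1
    ring
  | I =>
    simp only [laplaceTwo, psiTwo, A, Q]
    congr 1
    ring
  | D =>
    simp only [laplaceTwo, psiTwo, A, Q]
    congr 1
    ring

/-! ### Path loss exponent 4. -/

section PathLossFour

variable {s y : ℝ}

/-- `ζ = η + iψ` is the square root in the open first quadrant of `g + 2i√s (r² + y²) = (r² + y² +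
i√s)² - (2ry)²`, so `η²` and `ψ²` are half of modulus plus and minus real part. -/
theorem etaFour_psiFour_spec (hs : 0 < s) (hy : 0 < y) (r : ℝ) :
    0 < etaFour r s y ∧ 0 < psiFour r s y ∧
    etaFour r s y * psiFour r s y = √s * (r ^ 2 + y ^ 2) ∧
    etaFour r s y ^ 2 - psiFour r s y ^ 2 = gFour r s y ∧
    etaFour r s y ^ 2 + psiFour r s y ^ 2 =
      √(gFour r s y ^ 2 + 4 * s * (r ^ 2 + y ^ 2) ^ 2) := by
  have hs' := Real.sqrt_pos.2 hs
  have ha : 0 < r ^ 2 + y ^ 2 := by positivity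
  set g := gFour r s y with hg
  set M := √(g ^ 2 + 4 * s * (r ^ 2 + y ^ 2) ^ 2) with hM
  have hM2 : M ^ 2 = g ^ 2 + 4 * s * (r ^ 2 + y ^ 2) ^ 2 := Real.sq_sqrt (by positivity)
  have hMg : |g| < M := by
    rw [hM, ← Real.sqrt_sq_eq_abs]
    exact Real.sqrt_lt_sqrt (sq_nonneg g) (lt_add_of_pos_right _ (by positivity))
  have h0 : 0 < M + g := by linarith [neg_abs_le g]
  have hη : 0 < etaFour r s y := by
    unfold etaFour
    rw [← hg, ← hM]
    have := Real.sqrt_pos.2 h0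
    positivity
  have hη2 : etaFour r s y ^ 2 = (M + g) / 2 := by
    unfold etaFour
    rw [← hg, ← hM, div_pow, Real.sq_sqrt h0.le, Real.sq_sqrt (by norm_num)]
  have hψ : 0 < psiFour r s y := by unfold psiFour; positivity
  have hηψ : etaFour r s y * psiFour r s y = √s * (r ^ 2 + y ^ 2) := by
    unfold psiFour; field_simp
  have hψ2 : psiFour r s y ^ 2 = (M - g) / 2 := by
    refine mul_left_cancel₀ (pow_pos hη 2).ne' ?_
    rw [← mul_pow, hηψ, mul_pow, Real.sq_sqrt hs.le, hη2]
    linear_combination (-1 / 4) * hM2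
  refine ⟨hη, hψ, hηψ, ?_, ?_⟩
  · rw [hη2, hψ2]; ring
  · rw [hη2, hψ2]; ring

/-- Differentiating `ζ²` gives `ζ' = 2r (r² - y² + i√s) / ζ`. This is the real part;
`hasDerivAt_psiFour` is the imaginary part. -/
theorem hasDerivAt_etaFour (hs : 0 < s) (hy : 0 < y) (r : ℝ) :
    HasDerivAt (fun r => etaFour r s y)
      (2 * r * ((r ^ 2 - y ^ 2) * etaFour r s y + √s * psiFour r s y) /
        (etaFour r s y ^ 2 + psiFour r s y ^ 2)) r := by
  obtain ⟨hη, hψ, hηψ, hd, hN⟩ := etaFour_psiFour_spec hs hy r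
  have hs' := Real.sqrt_pos.2 hs
  have hN0 : 0 < etaFour r s y ^ 2 + psiFour r s y ^ 2 := by positivity
  have hg : HasDerivAt (fun r => gFour r s y) (4 * r * (r ^ 2 - y ^ 2)) r := by
    refine ((((hasDerivAt_pow 2 r).sub_const (y ^ 2)).fun_pow 2).sub_const s).congr_deriv ?_
    push_cast; ring
  have ha : HasDerivAt (fun r : ℝ => 4 * s * (r ^ 2 + y ^ 2) ^ 2)
      (16 * s * r * (r ^ 2 + y ^ 2)) r := by
    refine ((((hasDerivAt_pow 2 r).add_const (y ^ 2)).fun_pow 2).const_mul (4 * s)).congr_deriv ?_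
    push_cast; ring
  have hpos : 0 < gFour r s y ^ 2 + 4 * s * (r ^ 2 + y ^ 2) ^ 2 :=
    Real.sqrt_pos.1 (hN ▸ hN0)
  have hMg : √(gFour r s y ^ 2 + 4 * s * (r ^ 2 + y ^ 2) ^ 2) + gFour r s y =
      2 * etaFour r s y ^ 2 := by rw [← hN, ← hd]; ring
  have h1 := ((((hg.fun_pow 2).fun_add ha).sqrt hpos.ne').fun_add hg).sqrt
    (by rw [hMg]; positivity) |>.div_const √2
  have h2 : √(2 * etaFour r s y ^ 2) = √2 * etaFour r s y := by
    rw [Real.sqrt_mul (by norm_num), Real.sqrt_sq hη.le]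
  refine h1.congr_deriv ?_
  rw [hMg, h2, ← hN]
  have h3 : √2 * √2 = (2 : ℝ) := Real.mul_self_sqrt (by norm_num)
  have h4 : √s * √s = s := Real.mul_self_sqrt hs.le
  set η := etaFour r s y
  set ψ := psiFour r s y
  have h5 : (0 : ℝ) < √2 := by norm_num
  push_cast
  field_simp
  rw [show √2 ^ 2 = (2 : ℝ) by rw [sq, h3], ← hd]
  linear_combination (-16 * r * √s) * hηψ - 16 * r * (r ^ 2 + y ^ 2) * h4

theorem hasDerivAt_psiFour (hs : 0 < s) (hy : 0 < y) (r : ℝ) :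
    HasDerivAt (fun r => psiFour r s y)
      (2 * r * (√s * etaFour r s y - (r ^ 2 - y ^ 2) * psiFour r s y) /
        (etaFour r s y ^ 2 + psiFour r s y ^ 2)) r := by
  obtain ⟨hη, hψ, hηψ, hd, hN⟩ := etaFour_psiFour_spec hs hy r
  have hN0 : 0 < etaFour r s y ^ 2 + psiFour r s y ^ 2 := by positivity
  have h1 := (((hasDerivAt_pow 2 r).add_const (y ^ 2)).const_mul √s).fun_div
    (hasDerivAt_etaFour hs hy r) hη.ne'
  refine h1.congr_deriv ?_
  rw [← hηψ]
  set η := etaFour r s y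
  set ψ := psiFour r s y
  push_cast
  field_simp
  ring

/-- Put `Z = ζ + r² - y² + i√s`. Then `Z' = 2r Z / ζ`, so `log Z` has derivative `2r / ζ`. The
arctangent is `π/2 - arg Z`, and the logarithm of the next lemma is `2 log |Z|`. The quotient `Re Z
/ Im Z` is used because `Im Z > 0` for every `r`, including `0`. -/
theorem hasDerivAt_arctan_term (hs : 0 < s) (hy : 0 < y) (r : ℝ) :
    HasDerivAt (fun r => Real.arctan ((etaFour r s y + r ^ 2 - y ^ 2) / (√s + psiFour r s y)))
      (2 * r * psiFour r s y / (etaFour r s y ^ 2 + psiFour r s y ^ 2)) r := by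
  obtain ⟨hη, hψ, hηψ, hd, hN⟩ := etaFour_psiFour_spec hs hy r
  have hs' := Real.sqrt_pos.2 hs
  have hN0 : 0 < etaFour r s y ^ 2 + psiFour r s y ^ 2 := by positivity
  have hY : 0 < √s + psiFour r s y := by positivity
  have h1 := ((((hasDerivAt_etaFour hs hy r).fun_add (hasDerivAt_pow 2 r)).sub_const
    (y ^ 2)).fun_div ((hasDerivAt_psiFour hs hy r).const_add √s) hY.ne').arctan
  refine h1.congr_deriv ?_
  set η := etaFour r s y
  set ψ := psiFour r s y
  push_cast
  have hXY : 0 < (√s + ψ) ^ 2 + (η + r ^ 2 - y ^ 2) ^ 2 := by positivity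
  field_simp
  ring

theorem hasDerivAt_log_term (hs : 0 < s) (hy : 0 < y) (r : ℝ) :
    HasDerivAt (fun r => Real.log ((etaFour r s y + r ^ 2 - y ^ 2) ^ 2 +
      (√s + psiFour r s y) ^ 2))
      (4 * r * etaFour r s y / (etaFour r s y ^ 2 + psiFour r s y ^ 2)) r := by
  obtain ⟨hη, hψ, hηψ, hd, hN⟩ := etaFour_psiFour_spec hs hy r
  have hs' := Real.sqrt_pos.2 hs
  have hN0 : 0 < etaFour r s y ^ 2 + psiFour r s y ^ 2 := by positivity
  have hXY : 0 < (etaFour r s y + r ^ 2 - y ^ 2) ^ 2 + (√s + psiFour r s y) ^ 2 := by positivity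
  have h1 := (((((hasDerivAt_etaFour hs hy r).fun_add (hasDerivAt_pow 2 r)).sub_const
    (y ^ 2)).fun_pow 2).fun_add (((hasDerivAt_psiFour hs hy r).const_add √s).fun_pow 2)).log
    hXY.ne'
  refine h1.congr_deriv ?_
  set η := etaFour r s y
  set ψ := psiFour r s y
  push_cast
  field_simp
  ring

/-- The antiderivative of `r ^ 4 * (2 * r * ψ / (η ^ 2 + ψ ^ 2))`. -/
theorem hasDerivAt_moment_term (hs : 0 < s) (hy : 0 < y) (r : ℝ) :
    HasDerivAt (fun r => 2 * √s * y ^ 2 * Real.log ((etaFour r s y + r ^ 2 - y ^ 2) ^ 2 +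
      (√s + psiFour r s y) ^ 2) -
      1 / 2 * ((r ^ 2 + 3 * y ^ 2) * psiFour r s y - 3 * √s * etaFour r s y) -
      (s - y ^ 4) *
        Real.arctan ((etaFour r s y + r ^ 2 - y ^ 2) / (√s + psiFour r s y)))
      (r ^ 4 * (2 * r * psiFour r s y / (etaFour r s y ^ 2 + psiFour r s y ^ 2))) r := by
  obtain ⟨hη, hψ, hηψ, hd, hN⟩ := etaFour_psiFour_spec hs hy r
  have hN0 : 0 < etaFour r s y ^ 2 + psiFour r s y ^ 2 := by positivity
  have h1 := (((hasDerivAt_log_term hs hy r).const_mul (2 * √s * y ^ 2)).fun_sub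
    (((((hasDerivAt_pow 2 r).add_const (3 * y ^ 2)).fun_mul (hasDerivAt_psiFour hs hy r)).fun_sub
      ((hasDerivAt_etaFour hs hy r).const_mul (3 * √s))).const_mul (1 / 2))).fun_sub
    ((hasDerivAt_arctan_term hs hy r).const_mul (s - y ^ 4))
  refine h1.congr_deriv ?_
  have h4 : √s * √s = s := Real.mul_self_sqrt hs.le
  unfold gFour at hd
  set η := etaFour r s y
  set ψ := psiFour r s y
  push_cast
  field_simp
  linear_combination r * (-2 * η * hηψ + ψ * hd + 3 * ψ * h4)

/-- At `r = 0` the radicand is `(y² + i√s)²`, so `η = y²` and the numerator vanishes. -/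
theorem arctan_term_zero (hs : 0 < s) (hy : 0 < y) :
    Real.arctan ((etaFour 0 s y + 0 ^ 2 - y ^ 2) / (√s + psiFour 0 s y)) = 0 := by
  obtain ⟨hη, hψ, hηψ, hd, hN⟩ := etaFour_psiFour_spec hs hy 0
  have hs2 : √s ^ 2 = s := Real.sq_sqrt hs.le
  unfold gFour at hd
  set η := etaFour 0 s y
  set ψ := psiFour 0 s y
  have h1 : (η ^ 2 + s) * (η ^ 2 - (y ^ 2) ^ 2) = 0 := by
    linear_combination η ^ 2 * hd + (η * ψ + √s * y ^ 2) * hηψ + y ^ 4 * hs2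
  have h2 : η ^ 2 = (y ^ 2) ^ 2 := by
    rcases mul_eq_zero.1 h1 with h | h
    · nlinarith [sq_nonneg η]
    · linarith
  have h3 : η = y ^ 2 := (pow_left_inj₀ hη.le (by positivity) two_ne_zero).1 h2
  simp [h3]

/-- The closed form has the inverted quotient, which requires `Re Z = η + r² - y² > 0`. This holds
for `r > 0` but fails at `r = 0`, so `arctanFour` is evaluated only at the two radii. -/
theorem arctanFour_eq (hs : 0 < s) (hy : 0 < y) {r : ℝ} (hr : 0 < r) :
    arctanFour r s y = Real.pi / 2 -
      Real.arctan ((etaFour r s y + r ^ 2 - y ^ 2) / (√s + psiFour r s y)) := by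
  obtain ⟨hη, hψ, hηψ, hd, hN⟩ := etaFour_psiFour_spec hs hy r
  have hs' := Real.sqrt_pos.2 hs
  have hs2 : √s ^ 2 = s := Real.sq_sqrt hs.le
  have hX : 0 < etaFour r s y + r ^ 2 - y ^ 2 := by
    unfold gFour at hd
    set η := etaFour r s y
    set ψ := psiFour r s y
    -- Eliminating `ψ` from the two relations; the positive right side forces `η > |r² - y²|`.
    have h1 : (η ^ 2 + s) * (η ^ 2 - (r ^ 2 - y ^ 2) ^ 2) = 4 * s * r ^ 2 * y ^ 2 := by
      linear_combination η ^ 2 * hd + (η * ψ + √s * (r ^ 2 + y ^ 2)) * hηψ +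
        (r ^ 2 + y ^ 2) ^ 2 * hs2
    have h2 : 0 < η ^ 2 - (r ^ 2 - y ^ 2) ^ 2 :=
      pos_of_mul_pos_right (h1 ▸ (by positivity : 0 < 4 * s * r ^ 2 * y ^ 2)) (by positivity)
    have h3 : |r ^ 2 - y ^ 2| < η := abs_lt_of_sq_lt_sq (by linarith) hη.le
    linarith [neg_abs_le (r ^ 2 - y ^ 2)]
  rw [arctanFour, ← Real.arctan_inv_of_pos (by positivity), inv_div]

end PathLossFour

/-- The angular integral has `σ = √s`, `a = r² + y²` and `b = 2ry`; the radial density is a multiple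
of the derivative of the arctangent term. -/
theorem FriendshipNetwork.HasNetworkLaw.laplaceInterference_four {Ω : Type*}
    [MeasurableSpace Ω] {P : Measure Ω} [IsProbabilityMeasure P] {net : FriendshipNetwork Ω}
    {Ξ : JammerPolicy} {R₁ R₂ lam lamE D : ℝ} (h : net.HasNetworkLaw P lam lamE D)
    (hlam : 0 ≤ lam) (hR₁ : 0 < R₁) (hR : R₁ ≤ R₂) (hRD : R₂ ≤ D) {s y : ℝ} (hs : 0 < s)
    (hy : 0 < y) {u : Plane} (hu : ‖u‖ = 1) :
    net.laplaceInterference Ξ 4 R₁ R₂ P (y • u) s = laplaceFour lam R₁ R₂ s y Ξ := by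
  have hD : 0 ≤ D := hR₁.le.trans (hR.trans hRD)
  have hs' := Real.sqrt_pos.2 hs
  have hs2 : √s ^ 2 = s := Real.sq_sqrt hs.le
  rw [h.laplaceInterference_eq_exp (n := 2) hlam hD (by norm_num) hR₁ hs hu]
  let N : ℝ → ℝ := fun r => etaFour r s y ^ 2 + psiFour r s y ^ 2
  have hang : ∀ r, r * ∫ θ in (-Real.pi)..Real.pi,
      s / (s + (r ^ 2 + y ^ 2 - 2 * r * y * Real.cos θ) ^ 2) =
      Real.pi * √s * (2 * r * psiFour r s y / N r) := fun r => by
    obtain ⟨hη, hψ, hηψ, hd, -⟩ := etaFour_psiFour_spec hs hy r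
    have e : ∀ θ, s / (s + (r ^ 2 + y ^ 2 - 2 * r * y * Real.cos θ) ^ 2) =
        s * (√s ^ 2 + ((r ^ 2 + y ^ 2) - 2 * r * y * Real.cos θ) ^ 2)⁻¹ := fun θ => by
      rw [hs2, div_eq_mul_inv]
    simp_rw [e, intervalIntegral.integral_const_mul]
    rw [integral_inv_add_sub_mul_cos_sq hs' (by positivity)
      (by rw [hd, gFour, hs2]; ring) hηψ hη hψ]
    simp only [N]
    have : s / √s = √s := Real.div_sqrt
    linear_combination (2 * r * Real.pi * psiFour r s y /
      (etaFour r s y ^ 2 + psiFour r s y ^ 2)) * this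
  simp_rw [hang]
  have hη : Continuous fun r => etaFour r s y := by unfold etaFour gFour; fun_prop
  have hψ : Continuous fun r => psiFour r s y :=
    Continuous.div (by fun_prop) hη fun r => (etaFour_psiFour_spec hs hy r).1.ne'
  have hcont : Continuous fun r => Real.pi * √s * (2 * r * psiFour r s y / N r) :=
    (Continuous.div (by fun_prop) (by fun_prop) fun r => by
      have := (etaFour_psiFour_spec hs hy r).1
      positivity).const_mul _
  have hB := fun r => (hasDerivAt_arctan_term hs hy r).const_mul (Real.pi * √s)
  have hM := fun r => ((hasDerivAt_moment_term hs hy r).const_mul (Real.pi * √s)).congr_deriv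
    (g' := r ^ 4 * (Real.pi * √s * (2 * r * psiFour r s y / N r))) (by simp only [N]; ring)
  rw [Ξ.integral_jamProb_mul (n := 4) (by norm_num) hR₁ hR hRD hcont hB hM,
    arctan_term_zero hs hy]
  cases Ξ with
  | E p =>
    simp only [laplaceFour, arctanFour_eq hs hy hR₁, arctanFour_eq hs hy (hR₁.trans_le hR)]
    congr 1
    ring
  | I =>
    simp only [laplaceFour, bigPsiFour, arctanFour_eq hs hy hR₁,
      arctanFour_eq hs hy (hR₁.trans_le hR), one_div, mul_inv]
    congr 1
    ring
  | D =>
    simp only [laplaceFour, bigPsiFour, arctanFour_eq hs hy hR₁,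
      arctanFour_eq hs hy (hR₁.trans_le hR), one_div, mul_inv]
    congr 1
    ring

theorem mainTheorem3 {Ω : Type*} [MeasurableSpace Ω] (P : Measure Ω) [IsProbabilityMeasure P]
    (net : FriendshipNetwork Ω) (lam lamE D R₁ R₂ α βe : ℝ)
    (hlam : 0 < lam) (hlamE : 0 < lamE) (hR₁ : 0 < R₁) (hR₁₂ : R₁ ≤ R₂) (hR₂ : R₂ ≤ D)
    (hα : 2 ≤ α) (hβe : 0 < βe) (Ξ : JammerPolicy)
    (hnet : net.HasNetworkLaw P lam lamE D)
    (u : Plane) (hu : ‖u‖ = 1) :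
    net.secrecyOutageProb Ξ α R₁ R₂ P βe ≤
        1 - Real.exp (-(2 * Real.pi * lamE *
          ∫ r in (0 : ℝ)..D, net.laplaceInterference Ξ α R₁ R₂ P (r • u) (βe * r ^ α) * r)) ∧
    (∫ r in (0 : ℝ)..D, 2 * lamE * Real.pi * r * Real.exp (-(lamE * Real.pi * r ^ 2)) *
          net.laplaceInterference Ξ α R₁ R₂ P (r • u) (βe * r ^ α)) ≤
        net.secrecyOutageProb Ξ α R₁ R₂ P βe ∧
    (α = 2 → ∀ r : ℝ, 0 < r → r ≤ D →
      net.laplaceInterference Ξ α R₁ R₂ P (r • u) (βe * r ^ α) =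
        laplaceTwo lam R₁ R₂ (βe * r ^ α) r Ξ) ∧
    (α = 4 → ∀ r : ℝ, 0 < r → r ≤ D →
      net.laplaceInterference Ξ α R₁ R₂ P (r • u) (βe * r ^ α) =
        laplaceFour lam R₁ R₂ (βe * r ^ α) r Ξ) := by
  have hD : 0 < D := hR₁.trans_le (hR₁₂.trans hR₂)
  have hα0 : 0 ≤ α := by linarith
  refine ⟨hnet.secrecyOutageProb_le hlam.le hlamE.le hD.le hα0 hR₁ hβe hu,
    hnet.le_secrecyOutageProb hlam.le hlamE.le hD.le hα0 hR₁ hβe hu, ?_, ?_⟩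
  · rintro rfl r hr -
    exact hnet.laplaceInterference_two hlam.le hR₁ hR₁₂ hR₂ (by positivity) hr hu
  · rintro rfl r hr -
    exact hnet.laplaceInterference_four hlam.le hR₁ hR₁₂ hR₂ (by positivity) hr hu
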